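/- Let $0\le p\le n$ be integers and let $\operatorname{Gr}_{n,p}$ be the Grassmann manifold of $p$-dimensional subspaces of $\mathbb{R}^n$, realised as the set of real symmetric $n\times n$ matrices $P$ with $P^2=P$ and $\operatorname{rank}P=p$. Its tangent space at $P$ is $\{\Delta=\Delta^T:\ \Delta P+P\Delta=\Delta\}$, with Riemannian metric $\langle X,Y\rangle_P=\operatorname{tr}(X^TY)$ (the canonical metric up to a constant factor). Let $I=I_{n,p}=\operatorname{diag}(1,\dots,1,0,\dots,0)$ with $p$ ones, let $\operatorname{Log}_I$ be the Riemannian logarithm at $I$ (the initial velocity of the minimizing geodesic $[0,1]\to\operatorname{Gr}_{n,p}$ from $I$; unique off the cut locus $\operatorname{Cut}(I)$ of $I$, and any choice of a minimizing one on the cut locus), and put $\bar P=\operatorname{Log}_I(P)$ and $[X,Y]=XY-YX$. For $P,Q,R\in\operatorname{Gr}_{n,p}$ let $$P\oplus Q=\exp([\bar P,I])\,Q\,\exp(-[\bar P,I]),\qquad \ominus P=\exp(-[\bar P,I])\,I\,\exp([\bar P,I]),$$ $$\operatorname{gyr}[P,Q]R=\bigl(\ominus(P\oplus Q)\bigr)\oplus\bigl(P\oplus(Q\oplus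 R)\bigr),\qquad \|P\|=\sqrt{\langle\bar P,\bar P\rangle_I},\qquad d(P,Q)=\|(\ominus P)\oplus Q\|.$$ Theorem. Let $P,Q\in\operatorname{Gr}_{n,p}$ be such that $P$, $Q$ and $P\oplus Q$ are not in $\operatorname{Cut}(I)$. Then the gyroautomorphism $\operatorname{gyr}[P,Q]$ maps $\operatorname{Gr}_{n,p}$ to itself, and it preserves the Grassmann gyrodistance: for all $R,S\in\operatorname{Gr}_{n,p}$ with $R\notin\operatorname{Cut}(I)$ one has $\operatorname{gyr}[P,Q]R\notin\operatorname{Cut}(I)$ and $$d\bigl(\operatorname{gyr}[P,Q]R,\ \operatorname{gyr}[P,Q]S\bigr)=d(R,S);$$ moreover, if $(\ominus R)\oplus S\notin\operatorname{Cut}(I)$, then also $\bigl(\ominus\operatorname{gyr}[P,Q]R\bigr)\oplus\operatorname{gyr}[P,Q]S\notin\operatorname{Cut}(I)$. -/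

import Mathlib

open Matrix

noncomputable section

namespace Grassmann

/-- `Gr n p`: the `p`-dimensional subspaces of `ℝⁿ`, as orthogonal projectors of rank `p`. -/
def Gr (n p : ℕ) : Set (Matrix (Fin n) (Fin n) ℝ) :=
  {P | Pᵀ = P ∧ P * P = P ∧ P.rank = p}

/-- The identity element `I_{n,p} = diag(1,…,1,0,…,0)` with `p` ones. -/
def base (n p : ℕ) : Matrix (Fin n) (Fin n) ℝ :=
  Matrix.diagonal fun i => if (i : ℕ) < p then 1 else 0

/-- The tangent space at `P` of the manifold of projectors: the symmetric `Δ` with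
`Δ P + P Δ = Δ`. -/
def tangent {n : ℕ} (P : Matrix (Fin n) (Fin n) ℝ) : Set (Matrix (Fin n) (Fin n) ℝ) :=
  {Δ | Δᵀ = Δ ∧ Δ * P + P * Δ = Δ}

/-- The Riemannian metric on tangent vectors: the Frobenius inner product (the canonical metric
up to a constant factor, with the same geodesics). -/
def frobInner {n : ℕ} (X Y : Matrix (Fin n) (Fin n) ℝ) : ℝ := (Xᵀ * Y).trace

/-- The Frobenius norm. -/
def frobNorm {n : ℕ} (X : Matrix (Fin n) (Fin n) ℝ) : ℝ := Real.sqrt (frobInner X X)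

/-- `v` is the derivative of the matrix curve `γ` at `t`, entry by entry. -/
def HasMatDerivAt {n : ℕ} (γ : ℝ → Matrix (Fin n) (Fin n) ℝ) (v : Matrix (Fin n) (Fin n) ℝ)
    (t : ℝ) : Prop :=
  ∀ i j, HasDerivAt (fun s => γ s i j) (v i j) t

/-- Geodesics of `Gr n p` for the metric induced from the Frobenius inner product: the curves in
`Gr n p` whose acceleration is everywhere normal to `Gr n p`. -/
def IsGeodesic {n : ℕ} (p : ℕ) (γ : ℝ → Matrix (Fin n) (Fin n) ℝ) : Prop :=
  (∀ t, γ t ∈ Gr n p) ∧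
    ∃ v a : ℝ → Matrix (Fin n) (Fin n) ℝ,
      (∀ t, HasMatDerivAt γ (v t) t) ∧ (∀ t, HasMatDerivAt v (a t) t) ∧
        ∀ t, ∀ Δ ∈ tangent (γ t), frobInner (a t) Δ = 0

/-- `Exp_P(Δ) = Q`: the geodesic from `P` with initial velocity `Δ` is at `Q` at time `1`. -/
def IsExp {n : ℕ} (p : ℕ) (P Δ Q : Matrix (Fin n) (Fin n) ℝ) : Prop :=
  ∃ γ : ℝ → Matrix (Fin n) (Fin n) ℝ,
    IsGeodesic p γ ∧ γ 0 = P ∧ HasMatDerivAt γ Δ 0 ∧ γ 1 = Q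

/-- `Δ` is the initial velocity of a minimizing geodesic `[0,1] → Gr n p` from `P` to `Q`. -/
def IsMinimizing {n : ℕ} (p : ℕ) (P Q Δ : Matrix (Fin n) (Fin n) ℝ) : Prop :=
  IsExp p P Δ Q ∧ ∀ Δ', IsExp p P Δ' Q → frobNorm Δ ≤ frobNorm Δ'

/-- The cut locus of `P` in `Gr n p`: the points beyond which no minimizing geodesic from `P`
remains minimizing. -/
def cutLocus {n : ℕ} (p : ℕ) (P : Matrix (Fin n) (Fin n) ℝ) :
    Set (Matrix (Fin n) (Fin n) ℝ) :=
  {Q | Q ∈ Gr n p ∧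
    ¬ ∃ Δ, IsMinimizing p P Q Δ ∧ ∃ t : ℝ, 1 < t ∧ ∃ Q', IsMinimizing p P Q' (t • Δ)}

/-- The Riemannian logarithm `Log_P(Q)`: the initial velocity of the minimizing geodesic from `P`
to `Q`. It is unique when `Q` is not in the cut locus of `P`; on the cut locus one of them is
chosen. -/
def log {n : ℕ} (p : ℕ) (P Q : Matrix (Fin n) (Fin n) ℝ) : Matrix (Fin n) (Fin n) ℝ :=
  Classical.epsilon fun Δ => IsMinimizing p P Q Δ

/-- The matrix commutator `[X, Y]`. -/
def comm {n : ℕ} (X Y : Matrix (Fin n) (Fin n) ℝ) : Matrix (Fin n) (Fin n) ℝ := X * Y - Y * X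

/-- `P ⊕ Q = exp([Log_I(P), I]) Q exp(-[Log_I(P), I])`, where `I = I_{n,p}`. -/
def gadd {n : ℕ} (p : ℕ) (P Q : Matrix (Fin n) (Fin n) ℝ) : Matrix (Fin n) (Fin n) ℝ :=
  NormedSpace.exp (comm (log p (base n p) P) (base n p)) * Q *
    NormedSpace.exp (-comm (log p (base n p) P) (base n p))

/-- `t ⊗ P = exp([t Log_I(P), I]) I exp(-[t Log_I(P), I])`, where `I = I_{n,p}`. -/
def gsmul {n : ℕ} (p : ℕ) (t : ℝ) (P : Matrix (Fin n) (Fin n) ℝ) :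
    Matrix (Fin n) (Fin n) ℝ :=
  NormedSpace.exp (comm (t • log p (base n p) P) (base n p)) * base n p *
    NormedSpace.exp (-comm (t • log p (base n p) P) (base n p))

/-- The inverse operation `⊖ P = (-1) ⊗ P`. -/
def gneg {n : ℕ} (p : ℕ) (P : Matrix (Fin n) (Fin n) ℝ) : Matrix (Fin n) (Fin n) ℝ :=
  gsmul p (-1) P

/-- The gyroautomorphism `gyr[P,Q]R = (⊖ (P ⊕ Q)) ⊕ (P ⊕ (Q ⊕ R))`. -/
def gyr {n : ℕ} (p : ℕ) (P Q R : Matrix (Fin n) (Fin n) ℝ) : Matrix (Fin n) (Fin n) ℝ :=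
  gadd p (gneg p (gadd p P Q)) (gadd p P (gadd p Q R))

/-- The Grassmann inner product `⟨P, Q⟩ = ⟨Log_I(P), Log_I(Q)⟩_I`. -/
def ginner {n : ℕ} (p : ℕ) (P Q : Matrix (Fin n) (Fin n) ℝ) : ℝ :=
  frobInner (log p (base n p) P) (log p (base n p) Q)

/-- The Grassmann norm. -/
def gnorm {n : ℕ} (p : ℕ) (P : Matrix (Fin n) (Fin n) ℝ) : ℝ := Real.sqrt (ginner p P P)

/-- The Grassmann gyrodistance `d(P, Q) = ‖⊖ P ⊕ Q‖`. -/
def gdist {n : ℕ} (p : ℕ) (P Q : Matrix (Fin n) (Fin n) ℝ) : ℝ :=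
  gnorm p (gadd p (gneg p P) Q)

end Grassmann

end

/-!
The gyroautomorphism `gyr[P, Q]` is the conjugation by an orthogonal matrix `O` that commutes with
the base point `I`, hence an isometry of the Grassmannian fixing `I`; everything else is
naturality of the constructions at `I` under such isometries.

By definition `P ⊕ ·` is the conjugation by the orthogonal matrix `exp [Log P, I]` (`gtrans`), so
`gyr[P, Q]` is a conjugation. Writing `X = P ⊕ Q`, one has `P ⊕ (Q ⊕ I) = P ⊕ Q = X`, since
`Q ⊕ I = Q`, and the conjugation by `gtrans (⊖X)` is inverse to the one by `gtrans X`, so that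
`gyr[P, Q]` sends `I` to `⊖X ⊕ X = I` (`exists_gyr_eq_conj`). This needs `Log (⊖X) = -Log X`. Off
the cut locus `⊖X` is the image of `X` under conjugation by the reflection `J = 2I - 1`
(`gneg_eq`), which fixes `I` and acts as `-1` on its tangent space, so that the claim is an instance
of the equivariance of `Log` (`log_conj`).

Equivariance of `Log` rests on the uniqueness of minimizing geodesics off the cut locus
(`IsMinimizing.unique`), which is proved by linear algebra. A geodesic from `P` with velocity `Δ`
is the orbit `exp (tΩ) P exp (-tΩ)` with `Ω = [Δ, P]` (`IsExp.tangent_and_eq`, because `[γ', γ]` is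
constant along a geodesic), so that its endpoint `Q` is given by `2Q - 1 = exp (2ΔJ) J`
(`isExp_iff`), with `J = 2P - 1` anticommuting with `Δ`. If `Δ v = λ v`, then `exp (ΔJ)` rotates the
plane of `v` and `J v` by the angle `λ`. Hence a velocity with an eigenvalue beyond `π/2` is not
minimizing: subtracting `π` from the angle in that plane keeps the endpoint and shortens `Δ`
(`exists_shorter`). If `Q` is off the cut locus, a minimizing velocity that stays minimizing
when stretched by some `t > 1` therefore has all eigenvalues strictly inside `(-π/2, π/2)`, and any
other minimizing velocity has eigenvalues in `[-π/2, π/2]`. As the cosine and sine of `2Δ` can be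
read off from `Q`, the two velocities have the same spectral decomposition
(`tangent_eq_of_exp_eq`).

In the gyrodistance the point `⊖R ⊕ S` may lie on the cut locus, where `Log` is only some
minimizing velocity. Its length is still invariant, given that a minimizing geodesic exists
(`exists_isMinimizing`). By compactness it is enough to join two points `P`, `Q` by some geodesic;
for this, a midpoint reflection `V` with `V J V = 2Q - 1` is built as the sign of `J + (2Q - 1) + Z`,
where `Z` exchanges `range P ∩ ker Q` with `range Q ∩ ker P`, which have the same dimension because
`P` and `Q` have the same rank (`exists_midpoint`). The velocity is then the arcsine of the part of
`V` anticommuting with `J` (`exists_isExp`).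
-/

noncomputable section

namespace Grassmann

/-! ### Calculus of matrix curves -/

section

section Calculus

open scoped Matrix.Norms.Operator

variable {n : ℕ} {A X Y : Matrix (Fin n) (Fin n) ℝ}

theorem hasMatDerivAt_iff {γ : ℝ → Matrix (Fin n) (Fin n) ℝ} {v : Matrix (Fin n) (Fin n) ℝ}
    {t : ℝ} : HasMatDerivAt γ v t ↔ HasDerivAt γ v t := by
  refine ⟨fun h => ?_, fun h i j => ?_⟩
  · have key : HasDerivAt (fun s => ∑ i, ∑ j, γ s i j • Matrix.single i j (1 : ℝ))
        (∑ i, ∑ j, v i j • Matrix.single i j (1 : ℝ)) t :=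
      HasDerivAt.fun_sum fun i _ => HasDerivAt.fun_sum fun j _ => (h i j).smul_const _
    have e : ∀ A : Matrix (Fin n) (Fin n) ℝ,
        ∑ i, ∑ j, A i j • Matrix.single i j (1 : ℝ) = A := fun A => by
      conv_rhs => rw [Matrix.matrix_eq_sum_single A]
      simp
    simpa only [e] using key
  · exact ((Matrix.entryLinearMap ℝ ℝ i j).toContinuousLinearMap.hasFDerivAt.comp_hasDerivAt t h)

theorem HasMatDerivAt.congr_deriv {γ : ℝ → Matrix (Fin n) (Fin n) ℝ} {t : ℝ}
    (hX : HasMatDerivAt γ X t) (h : X = Y) : HasMatDerivAt γ Y t := h ▸ hX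

theorem hasMatDerivAt_unique {γ : ℝ → Matrix (Fin n) (Fin n) ℝ} {t : ℝ}
    (hX : HasMatDerivAt γ X t) (hY : HasMatDerivAt γ Y t) : X = Y := by
  ext i j
  exact (hX i j).unique (hY i j)

theorem HasMatDerivAt.transpose {γ : ℝ → Matrix (Fin n) (Fin n) ℝ} {t : ℝ}
    (hX : HasMatDerivAt γ X t) : HasMatDerivAt (fun s => (γ s)ᵀ) Xᵀ t :=
  fun i j => hX j i

theorem HasMatDerivAt.mul {γ δ : ℝ → Matrix (Fin n) (Fin n) ℝ} {t : ℝ}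
    (hX : HasMatDerivAt γ X t) (hY : HasMatDerivAt δ Y t) :
    HasMatDerivAt (fun s => γ s * δ s) (X * δ t + γ t * Y) t :=
   hasMatDerivAt_iff.2 ((hasMatDerivAt_iff.1 hX).mul (hasMatDerivAt_iff.1 hY))

theorem HasMatDerivAt.sub {γ δ : ℝ → Matrix (Fin n) (Fin n) ℝ} {t : ℝ}
    (hX : HasMatDerivAt γ X t) (hY : HasMatDerivAt δ Y t) :
    HasMatDerivAt (fun s => γ s - δ s) (X - Y) t := fun i j => (hX i j).sub (hY i j)

theorem hasMatDerivAt_exp_smul (A : Matrix (Fin n) (Fin n) ℝ) (t : ℝ) :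
    HasMatDerivAt (fun s : ℝ => NormedSpace.exp (s • A)) (A * NormedSpace.exp (t • A)) t :=
  hasMatDerivAt_iff.2 (hasDerivAt_exp_smul_const' A t)

theorem eq_of_hasMatDerivAt_zero {F : ℝ → Matrix (Fin n) (Fin n) ℝ}
    (h : ∀ t, HasMatDerivAt F 0 t) (s t : ℝ) : F s = F t :=
  is_const_of_deriv_eq_zero (fun t => (hasMatDerivAt_iff.1 (h t)).differentiableAt)
    (fun t => (hasMatDerivAt_iff.1 (h t)).deriv) s t

theorem commute_exp (h : Commute A X) : Commute (NormedSpace.exp A) X := h.exp_left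

end Calculus

variable {n : ℕ} {A B X Y : Matrix (Fin n) (Fin n) ℝ}

theorem exp_mul_exp_neg (A : Matrix (Fin n) (Fin n) ℝ) :
    NormedSpace.exp A * NormedSpace.exp (-A) = 1 := by
  rw [← Matrix.exp_add_of_commute _ _ (Commute.neg_right (Commute.refl A)), add_neg_cancel,
    NormedSpace.exp_zero]

theorem exp_neg_mul_exp (A : Matrix (Fin n) (Fin n) ℝ) :
    NormedSpace.exp (-A) * NormedSpace.exp A = 1 := by
  simpa using exp_mul_exp_neg (-A)

/-- A matrix curve satisfying the linear equation `F' = Ω F` is `t ↦ exp (tΩ) F(0)`. -/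
theorem eq_exp_mul_of_deriv {Ω : Matrix (Fin n) (Fin n) ℝ}
    {F : ℝ → Matrix (Fin n) (Fin n) ℝ} (h : ∀ t, HasMatDerivAt F (Ω * F t) t) (t : ℝ) :
    F t = NormedSpace.exp (t • Ω) * F 0 := by
  have key : ∀ t, HasMatDerivAt (fun s : ℝ => NormedSpace.exp (s • (-Ω)) * F s) 0 t := by
    intro t
    refine ((hasMatDerivAt_exp_smul (-Ω) t).mul (h t)).congr_deriv ?_
    have hc : Ω * NormedSpace.exp (t • (-Ω)) = NormedSpace.exp (t • (-Ω)) * Ω :=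
      (commute_exp ((Commute.refl Ω).neg_left.smul_left t)).eq.symm
    rw [neg_mul, hc, neg_mul, mul_assoc, neg_add_cancel]
  have := eq_of_hasMatDerivAt_zero key t 0
  simp only [zero_smul, NormedSpace.exp_zero, one_mul] at this
  rw [smul_neg] at this
  rw [← this, ← mul_assoc, exp_mul_exp_neg, one_mul]

/-- The curve generated by a commutator equation `F' = Ω F - F Ω` is a conjugation orbit. -/
theorem eq_conj_of_deriv {Ω : Matrix (Fin n) (Fin n) ℝ}
    {F : ℝ → Matrix (Fin n) (Fin n) ℝ} (h : ∀ t, HasMatDerivAt F (Ω * F t - F t * Ω) t) (t : ℝ) :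
    F t = NormedSpace.exp (t • Ω) * F 0 * NormedSpace.exp (-(t • Ω)) := by
  have key : ∀ t, HasMatDerivAt (fun s : ℝ => F s * NormedSpace.exp (s • Ω))
      (Ω * (F t * NormedSpace.exp (t • Ω))) t := by
    intro t
    refine ((h t).mul (hasMatDerivAt_exp_smul Ω t)).congr_deriv ?_
    noncomm_ring
  have := eq_exp_mul_of_deriv key t
  simp only [zero_smul, NormedSpace.exp_zero, mul_one] at this
  rw [← this, mul_assoc, exp_mul_exp_neg, mul_one]

/-- If `Ω` acts on the pair `(A, B)` as an infinitesimal rotation of speed `l`, then `exp Ω`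
acts as the rotation by the angle `l`. -/
theorem exp_mul_of_rotation {Ω A B : Matrix (Fin n) (Fin n) ℝ} {l : ℝ}
    (hA : Ω * A = -(l • B)) (hB : Ω * B = l • A) :
    NormedSpace.exp Ω * A = Real.cos l • A - Real.sin l • B := by
  have key : ∀ t, HasMatDerivAt (fun s : ℝ => Real.cos (s * l) • A - Real.sin (s * l) • B)
      (Ω * (Real.cos (t * l) • A - Real.sin (t * l) • B)) t := by
    intro t
    have hl : HasDerivAt (fun s : ℝ => s * l) l t := by
      simpa using (hasDerivAt_id t).mul_const l
    refine HasMatDerivAt.congr_deriv (X := (-Real.sin (t * l) * l) • A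
      - (Real.cos (t * l) * l) • B)
      (fun i j => (hl.cos.mul_const (A i j)).sub (hl.sin.mul_const (B i j))) ?_
    rw [mul_sub, mul_smul_comm, mul_smul_comm, hA, hB]
    module
  have := eq_exp_mul_of_deriv key 1
  simpa using this.symm

/-! ### The differential equation of a geodesic -/

theorem eq_zero_of_frobInner_self_eq_zero (h : frobInner X X = 0) : X = 0 := by
  rw [frobInner, ← Matrix.conjTranspose_eq_transpose_of_trivial] at h
  exact Matrix.trace_conjTranspose_mul_self_eq_zero_iff.1 h

/-- A symmetric matrix orthogonal to the tangent space at `P` commutes with `P`. -/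
theorem commute_of_normal {P a : Matrix (Fin n) (Fin n) ℝ} (hPt : Pᵀ = P) (hP : P * P = P)
    (ha : aᵀ = a) (hn : ∀ Δ ∈ tangent P, frobInner a Δ = 0) : a * P = P * a := by
  -- the tangential part of `a`
  set T := a * P + P * a - (2 : ℝ) • (P * a * P) with hT
  have hTt : Tᵀ = T := by
    simp only [hT, transpose_add, transpose_sub, transpose_mul, transpose_smul, hPt, ha, mul_assoc]
    abel
  have hPP : ∀ X, P * (P * X) = P * X := fun X => by rw [← mul_assoc, hP]
  have hT1 : T * P + P * T = T := by
    simp only [hT, mul_add, add_mul, mul_sub, sub_mul, mul_assoc, hP, hPP, smul_mul_assoc,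
      mul_smul_comm]
    module
  have h0 := hn T ⟨hTt, hT1⟩
  have hPTP : P * T * P = 0 := by
    simp only [hT, mul_add, add_mul, mul_sub, sub_mul, mul_assoc, hP, hPP, smul_mul_assoc,
      mul_smul_comm]
    module
  have hTT : frobInner T T = 0 := by
    have e : frobInner T T = frobInner a T := by
      have h1 : T * T = (a * P + P * a) * T - (2 : ℝ) • (P * (a * P) * T) := by
        rw [hT]; simp only [sub_mul, smul_mul_assoc, mul_assoc]
      have h2 : (P * (a * P) * T).trace = 0 := by
        rw [mul_assoc, trace_mul_comm, mul_assoc, mul_assoc, ← mul_assoc P T P, hPTP, mul_zero,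
          trace_zero]
      have h3 : ((a * P + P * a) * T).trace = (a * T).trace := by
        rw [add_mul, trace_add, mul_assoc P, trace_mul_comm P, mul_assoc, mul_assoc, ← trace_add,
          ← mul_add, add_comm, hT1]
      rw [frobInner, frobInner, hTt, ha, h1, trace_sub, h3, trace_smul, h2, smul_zero, sub_zero]
    rw [e, h0]
  have hT0 := eq_zero_of_frobInner_self_eq_zero hTT
  have h1 : T * P = 0 := by rw [hT0, zero_mul]
  have h2 : P * T = 0 := by rw [hT0, mul_zero]
  have h1' : a * P = P * (a * P) := by
    rw [← sub_eq_zero, ← h1, hT]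
    simp only [add_mul, sub_mul, mul_assoc, hP, smul_mul_assoc]
    module
  have h2' : P * a = P * (a * P) := by
    rw [← sub_eq_zero, ← h2, hT]
    simp only [mul_add, mul_sub, mul_assoc, hPP, mul_smul_comm]
    module
  rw [h1', ← h2']

/-- A geodesic is determined by its initial point and velocity: `[γ', γ]` is constant along it,
so that `γ` solves `γ' = [Ω, γ]` with `Ω = [γ'(0), γ(0)]`. -/
theorem IsExp.tangent_and_eq {p : ℕ} {P Δ Q : Matrix (Fin n) (Fin n) ℝ} (h : IsExp p P Δ Q) :
    Δ ∈ tangent P ∧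
      Q = NormedSpace.exp (comm Δ P) * P * NormedSpace.exp (-comm Δ P) := by
  obtain ⟨γ, ⟨hG, v, a, hv, ha, hn⟩, rfl, hΔ, rfl⟩ := h
  have hγt : ∀ t, (γ t)ᵀ = γ t := fun t => (hG t).1
  have hγγ : ∀ t, γ t * γ t = γ t := fun t => (hG t).2.1
  have hvt : ∀ t, (v t)ᵀ = v t := fun t => by
    refine hasMatDerivAt_unique (γ := γ) (t := t) ?_ (hv t)
    simpa only [hγt] using (hv t).transpose
  have hat : ∀ t, (a t)ᵀ = a t := fun t => by
    refine hasMatDerivAt_unique (γ := v) (t := t) ?_ (ha t)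
    simpa only [hvt] using (ha t).transpose
  have hvγ : ∀ t, v t * γ t + γ t * v t = v t := fun t => by
    refine hasMatDerivAt_unique (γ := γ) (t := t) ?_ (hv t)
    simpa only [hγγ] using (hv t).mul (hv t)
  have hcomm : ∀ t, a t * γ t = γ t * a t := fun t =>
    commute_of_normal (hγt t) (hγγ t) (hat t) (hn t)
  have hΩ : ∀ t, comm (v t) (γ t) = comm (v 0) (γ 0) := by
    intro t
    refine eq_of_hasMatDerivAt_zero (F := fun s => comm (v s) (γ s)) (fun s => ?_) t 0
    refine (((ha s).mul (hv s)).sub ((hv s).mul (ha s))).congr_deriv ?_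
    rw [hcomm s]
    abel
  have hv0 : v 0 = Δ := hasMatDerivAt_unique (hv 0) hΔ
  refine ⟨hv0 ▸ ⟨hvt 0, hvγ 0⟩, ?_⟩
  have hode : ∀ t, HasMatDerivAt γ (comm (v 0) (γ 0) * γ t - γ t * comm (v 0) (γ 0)) t := by
    intro t
    have hgvg : γ t * v t * γ t = 0 := by
      have := congrArg (fun X => γ t * X) (hvγ t)
      simpa only [mul_add, ← mul_assoc, hγγ, add_eq_right] using this
    convert hv t using 1
    rw [← hΩ t]
    conv_rhs => rw [← hvγ t]
    simp only [comm, sub_mul, mul_sub, mul_assoc, hγγ]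
    rw [← mul_assoc (γ t) (γ t), hγγ, ← mul_assoc (γ t) (v t), hgvg]
    abel
  simpa [hv0] using eq_conj_of_deriv hode 1

end

/-! ### Geodesics as conjugation orbits -/

section

variable {n : ℕ} {A B X Y : Matrix (Fin n) (Fin n) ℝ}

theorem transpose_exp_of_skew (h : Aᵀ = -A) : (NormedSpace.exp A)ᵀ = NormedSpace.exp (-A) := by
  rw [← Matrix.exp_transpose, h]

theorem conj_mem_Gr {p : ℕ} {O P : Matrix (Fin n) (Fin n) ℝ} (hO : Oᵀ * O = 1)
    (hP : P ∈ Gr n p) : O * P * Oᵀ ∈ Gr n p := by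
  have hO' : O * Oᵀ = 1 := mul_eq_one_comm.1 hO
  refine ⟨?_, ?_, ?_⟩
  · simp only [transpose_mul, transpose_transpose, hP.1, mul_assoc]
  · calc O * P * Oᵀ * (O * P * Oᵀ) = O * P * (Oᵀ * O) * P * Oᵀ := by simp only [mul_assoc]
      _ = O * P * Oᵀ := by rw [hO, mul_one, mul_assoc O, hP.2.1]
  · have h1 : IsUnit O.det := (Matrix.isUnit_iff_isUnit_det O).1
      (IsUnit.of_mul_eq_one _ hO')
    have h2 : IsUnit Oᵀ.det := by rwa [Matrix.det_transpose]
    rw [Matrix.rank_mul_eq_left_of_isUnit_det _ _ h2, Matrix.rank_mul_eq_right_of_isUnit_det _ _ h1,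
      hP.2.2]

theorem base_mem_Gr {p : ℕ} (hp : p ≤ n) : base n p ∈ Gr n p := by
  refine ⟨Matrix.diagonal_transpose _, ?_, ?_⟩
  · rw [base, Matrix.diagonal_mul_diagonal]
    congr 1
    ext i
    split_ifs <;> simp
  · rw [base, Matrix.rank_diagonal]
    simp only [ne_eq, ite_eq_right_iff, one_ne_zero, imp_false, not_not]
    rw [Fintype.card_subtype]
    have : (Finset.univ.filter fun i : Fin n => (i : ℕ) < p)
        = (Finset.univ : Finset (Fin p)).map (Fin.castLEEmb hp) := by
      ext i
      simp only [Finset.mem_filter, Finset.mem_univ, true_and, Finset.mem_map, Fin.castLEEmb_apply]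
      exact ⟨fun h => ⟨⟨i, h⟩, rfl⟩, fun ⟨j, hj⟩ => hj ▸ j.2⟩
    rw [this, Finset.card_map, Finset.card_univ, Fintype.card_fin]

/-- The orthogonal reflection in the range of the projector `P`. -/
def refl (P : Matrix (Fin n) (Fin n) ℝ) : Matrix (Fin n) (Fin n) ℝ := (2 : ℝ) • P - 1

theorem refl_injective {P Q : Matrix (Fin n) (Fin n) ℝ} (h : refl P = refl Q) : P = Q := by
  have h2 : (2 : ℝ) • P = (2 : ℝ) • Q := sub_left_injective h
  exact smul_right_injective _ (two_ne_zero' ℝ) h2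

theorem refl_mul_self {P : Matrix (Fin n) (Fin n) ℝ} (h : P * P = P) : refl P * refl P = 1 := by
  simp only [refl, mul_sub, sub_mul, smul_mul_assoc, mul_smul_comm, h, mul_one, one_mul]
  module

theorem transpose_refl {P : Matrix (Fin n) (Fin n) ℝ} (h : Pᵀ = P) : (refl P)ᵀ = refl P := by
  simp [refl, h]

theorem refl_conj {O O' P : Matrix (Fin n) (Fin n) ℝ} (h : O * O' = 1) :
    refl (O * P * O') = O * refl P * O' := by
  simp [refl, mul_sub, sub_mul, h]

theorem mem_tangent_iff {P Δ : Matrix (Fin n) (Fin n) ℝ} :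
    Δ ∈ tangent P ↔ Δᵀ = Δ ∧ Δ * refl P = -(refl P * Δ) := by
  have e : Δ * P + P * Δ - Δ = (2⁻¹ : ℝ) • (Δ * refl P + refl P * Δ) := by
    simp only [refl, mul_sub, sub_mul, smul_mul_assoc, mul_smul_comm, mul_one, one_mul]
    module
  refine and_congr_right fun _ => ?_
  rw [← sub_eq_zero, e, smul_eq_zero_iff_right (by norm_num), eq_neg_iff_add_eq_zero]

theorem comm_eq_mul_refl {P Δ : Matrix (Fin n) (Fin n) ℝ} (h : Δ ∈ tangent P) :
    comm Δ P = Δ * refl P := by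
  have := h.2
  have e : P * Δ = Δ - Δ * P := eq_sub_of_add_eq' this
  simp only [refl, mul_sub, mul_smul_comm, mul_one, comm, e]
  module

theorem transpose_comm {P Δ : Matrix (Fin n) (Fin n) ℝ} (hP : Pᵀ = P) (h : Δᵀ = Δ) :
    (comm Δ P)ᵀ = -(comm Δ P) := by
  simp [comm, hP, h]

theorem trace_mul_tangent_eq_zero {P Δ : Matrix (Fin n) (Fin n) ℝ} (hP : P * P = P)
    (hA : A * P = P * A) (h : Δ * P + P * Δ = Δ) : (A * Δ).trace = 0 := by
  have h1 : (A * (Δ * P)).trace = (A * (P * Δ)).trace := by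
    rw [← mul_assoc, trace_mul_comm, ← mul_assoc, ← hA, mul_assoc]
  have hPΔP : P * Δ * P = 0 := by
    have := congrArg (fun X => P * X) h
    simpa only [mul_add, ← mul_assoc, hP, add_eq_right] using this
  have h2 : (A * (P * Δ)).trace = 0 := by
    rw [← hP, mul_assoc, ← mul_assoc, hA, mul_assoc, trace_mul_comm, mul_assoc, hPΔP, mul_zero,
      trace_zero]
  rw [← h, mul_add, trace_add, h1, h2, add_zero]

/-- The one-parameter conjugation orbit `t ↦ exp (tΩ) P exp (-tΩ)`, with `Ω = [Δ, P]`, is a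
geodesic with initial velocity `Δ`; its acceleration is the conjugate of `[Ω, Δ]`, which commutes
with `P` and is therefore normal. -/
theorem isExp_of_tangent {p : ℕ} {P Δ : Matrix (Fin n) (Fin n) ℝ} (hP : P ∈ Gr n p)
    (hΔ : Δ ∈ tangent P) :
    IsExp p P Δ (NormedSpace.exp (comm Δ P) * P * NormedSpace.exp (-comm Δ P)) := by
  set Ω := comm Δ P with hΩ
  have hPP := hP.2.1
  have e : P * Δ = Δ - Δ * P := eq_sub_of_add_eq' hΔ.2
  have hΩt : Ωᵀ = -Ω := transpose_comm hP.1 hΔ.1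
  have hPΔP : P * (Δ * P) = 0 := by rw [← mul_assoc, e, sub_mul, mul_assoc, hPP, sub_self]
  have hΩP : Ω * P - P * Ω = Δ := by
    simp only [hΩ, comm, mul_sub, sub_mul]
    rw [mul_assoc Δ P, mul_assoc P Δ, ← mul_assoc P P, hPP, hPΔP, e]
    abel
  have hcom : ∀ t : ℝ, Ω * NormedSpace.exp (t • Ω) = NormedSpace.exp (t • Ω) * Ω := fun t =>
    (commute_exp ((Commute.refl Ω).smul_left t)).eq.symm
  -- derivative of a conjugation orbit
  have hd : ∀ (Y : Matrix (Fin n) (Fin n) ℝ) (t : ℝ),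
      HasMatDerivAt (fun s : ℝ => NormedSpace.exp (s • Ω) * Y * NormedSpace.exp (s • -Ω))
        (NormedSpace.exp (t • Ω) * (Ω * Y - Y * Ω) * NormedSpace.exp (t • -Ω)) t := by
    intro Y t
    have hc : HasMatDerivAt (fun s : ℝ => Y * NormedSpace.exp (s • -Ω))
        (Y * (-Ω * NormedSpace.exp (t • -Ω))) t := by
      refine (HasMatDerivAt.mul (X := 0) (γ := fun _ => Y) (fun i j => hasDerivAt_const _ _)
        (hasMatDerivAt_exp_smul (-Ω) t)).congr_deriv ?_
      rw [zero_mul, zero_add]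
    have := (hasMatDerivAt_exp_smul Ω t).mul hc
    simp only [← mul_assoc] at this
    refine this.congr_deriv ?_
    rw [hcom]
    noncomm_ring
  have hEt : ∀ t : ℝ, (NormedSpace.exp (t • Ω))ᵀ = NormedSpace.exp (t • -Ω) := fun t => by
    rw [transpose_exp_of_skew, smul_neg]
    rw [transpose_smul, hΩt, smul_neg]
  have hEE : ∀ t : ℝ, NormedSpace.exp (t • -Ω) * NormedSpace.exp (t • Ω) = 1 := fun t => by
    rw [smul_neg, exp_neg_mul_exp]
  refine ⟨fun t => NormedSpace.exp (t • Ω) * P * NormedSpace.exp (t • -Ω), ⟨fun t => ?_,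
    fun t => NormedSpace.exp (t • Ω) * Δ * NormedSpace.exp (t • -Ω),
    fun t => NormedSpace.exp (t • Ω) * (Ω * Δ - Δ * Ω) * NormedSpace.exp (t • -Ω),
    fun t => (hd P t).congr_deriv (by rw [hΩP]), fun t => hd Δ t, fun t T hT => ?_⟩, ?_, ?_, ?_⟩
  · simp only [← hEt]
    exact conj_mem_Gr (by rw [hEt, hEE]) hP
  · have hΔΔP : P * (Δ * Δ) = Δ * Δ * P := by
      rw [← mul_assoc, e, sub_mul, mul_assoc, e, mul_sub, mul_assoc]; abel
    have hN : Ω * Δ - Δ * Ω = (2 : ℝ) • (Δ * Δ) - (4 : ℝ) • (Δ * Δ * P) := by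
      simp only [hΩ, comm, sub_mul, mul_sub]
      rw [mul_assoc P, hΔΔP, mul_assoc Δ P, e, mul_sub, ← mul_assoc]
      module
    have hNP : (Ω * Δ - Δ * Ω) * P = P * (Ω * Δ - Δ * Ω) := by
      rw [hN]
      simp only [sub_mul, mul_sub, smul_mul_assoc, mul_smul_comm]
      rw [← mul_assoc P (Δ * Δ), hΔΔP]
    have hNt : (Ω * Δ - Δ * Ω)ᵀ = Ω * Δ - Δ * Ω := by
      rw [transpose_sub, transpose_mul, transpose_mul, hΩt, hΔ.1]
      noncomm_ring
    have hEE' : ∀ Z, NormedSpace.exp (t • -Ω) * (NormedSpace.exp (t • Ω) * Z) = Z := fun Z => by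
      rw [← mul_assoc, hEE, one_mul]
    have hstar : (NormedSpace.exp (t • -Ω))ᵀ = NormedSpace.exp (t • Ω) := by
      rw [← hEt, transpose_transpose]
    refine trace_mul_tangent_eq_zero (P := NormedSpace.exp (t • Ω) * P * NormedSpace.exp (t • -Ω))
      ?_ ?_ hT.2
    · simp only [mul_assoc, hEE']
      rw [← mul_assoc P P, hPP]
    · simp only [transpose_mul, hNt, hEt, hstar, mul_assoc, hEE']
      rw [← mul_assoc _ P, hNP, mul_assoc]
  · simp
  · refine (hd P 0).congr_deriv ?_
    simp [hΩP]
  · simp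

theorem refl_exp {P Δ : Matrix (Fin n) (Fin n) ℝ} (hP : P * P = P) (hΔ : Δ ∈ tangent P) :
    refl (NormedSpace.exp (comm Δ P) * P * NormedSpace.exp (-comm Δ P)) =
      NormedSpace.exp ((2 : ℝ) • (Δ * refl P)) * refl P := by
  have hJ := refl_mul_self hP
  have hinv : (refl P)⁻¹ = refl P := Matrix.inv_eq_left_inv hJ
  have hu : IsUnit (refl P) := IsUnit.of_mul_eq_one _ hJ
  rw [refl_conj (exp_mul_exp_neg _), comm_eq_mul_refl hΔ]
  have h1 : refl P * NormedSpace.exp (-(Δ * refl P)) =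
      NormedSpace.exp (Δ * refl P) * refl P := by
    have := Matrix.exp_conj (refl P) (Δ * refl P) hu
    rw [hinv, mul_assoc, mul_assoc Δ, hJ, mul_one] at this
    have e : -(Δ * refl P) = refl P * Δ := by rw [(mem_tangent_iff.1 hΔ).2, neg_neg]
    rw [e, this, ← mul_assoc, ← mul_assoc, hJ, one_mul]
  rw [mul_assoc, h1, ← mul_assoc, two_smul, ← Matrix.exp_add_of_commute _ _ (Commute.refl _)]

/-- Endpoints of geodesics in terms of reflections: `Exp_P(Δ) = Q` means that the product of the
reflections in `Q` and `P` is `exp (2ΔJ)`, where `J` is the reflection in `P`. -/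
theorem isExp_iff {p : ℕ} {P Δ Q : Matrix (Fin n) (Fin n) ℝ} (hP : P ∈ Gr n p) :
    IsExp p P Δ Q ↔
      Δ ∈ tangent P ∧ refl Q = NormedSpace.exp ((2 : ℝ) • (Δ * refl P)) * refl P := by
  constructor
  · intro h
    obtain ⟨hΔ, rfl⟩ := h.tangent_and_eq
    exact ⟨hΔ, refl_exp hP.2.1 hΔ⟩
  · rintro ⟨hΔ, h⟩
    rw [← refl_exp hP.2.1 hΔ] at h
    rw [refl_injective h]
    exact isExp_of_tangent hP hΔ

end

/-! ### Symmetric matrices and their eigenvectors -/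

section

variable {n : ℕ} {A B X Y : Matrix (Fin n) (Fin n) ℝ}

theorem exists_orthogonal_diagonalization (hA : Aᵀ = A) :
    ∃ (U : Matrix (Fin n) (Fin n) ℝ) (d : Fin n → ℝ), Uᵀ * U = 1 ∧ A * U = U * diagonal d := by
  have hH : A.IsHermitian := by
    rw [Matrix.IsHermitian, Matrix.conjTranspose_eq_transpose_of_trivial, hA]
  have hU : (hH.eigenvectorUnitary : Matrix (Fin n) (Fin n) ℝ)ᵀ * hH.eigenvectorUnitary = 1 := by
    have := Unitary.coe_star_mul_self hH.eigenvectorUnitary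
    rwa [Matrix.star_eq_conjTranspose, Matrix.conjTranspose_eq_transpose_of_trivial] at this
  refine ⟨hH.eigenvectorUnitary, hH.eigenvalues, hU, ?_⟩
  have h := hH.spectral_theorem
  rw [Unitary.conjStarAlgAut_apply, Matrix.star_eq_conjTranspose,
    Matrix.conjTranspose_eq_transpose_of_trivial] at h
  calc A * (hH.eigenvectorUnitary : Matrix (Fin n) (Fin n) ℝ)
      = _ * (hH.eigenvectorUnitary : Matrix (Fin n) (Fin n) ℝ) := congrArg (· * _) h
    _ = _ := by rw [mul_assoc, hU, mul_one]; rfl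

theorem mulVec_eq_of_mul_eq_mul_diagonal {U : Matrix (Fin n) (Fin n) ℝ} {d : Fin n → ℝ}
    (h : A * U = U * diagonal d) (j : Fin n) : A *ᵥ Uᵀ j = d j • Uᵀ j := by
  ext i
  have := congrFun (congrFun h i) j
  rw [Matrix.mul_diagonal, Matrix.mul_apply] at this
  simpa [Matrix.mulVec, dotProduct, mul_comm] using this

theorem eq_of_mulVec_eq {U : Matrix (Fin n) (Fin n) ℝ} (hU : Uᵀ * U = 1)
    (h : ∀ j, A *ᵥ Uᵀ j = B *ᵥ Uᵀ j) : A = B := by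
  have e : A * U = B * U := by
    ext i j
    simpa [Matrix.mulVec, dotProduct, Matrix.mul_apply] using congrFun (h j) i
  calc A = A * U * Uᵀ := by rw [mul_assoc, mul_eq_one_comm.1 hU, mul_one]
    _ = B := by rw [e, mul_assoc, mul_eq_one_comm.1 hU, mul_one]

theorem eigenvalue_eq_of_dotProduct_ne_zero {v w : Fin n → ℝ} {x y : ℝ} (hX : Xᵀ = X)
    (hv : X *ᵥ v = x • v) (hw : X *ᵥ w = y • w) (h : v ⬝ᵥ w ≠ 0) : x = y := by
  have e : (X *ᵥ v) ⬝ᵥ w = v ⬝ᵥ (X *ᵥ w) := by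
    rw [Matrix.dotProduct_mulVec, ← Matrix.mulVec_transpose, hX]
  rw [hv, hw, smul_dotProduct, dotProduct_smul, smul_eq_mul, smul_eq_mul] at e
  exact mul_right_cancel₀ h e

/-- Symmetric matrices are equal as soon as eigenvectors of the one and of the other with
different eigenvalues are orthogonal. -/
theorem eq_of_eigenvectors (hA : Aᵀ = A) (hB : Bᵀ = B)
    (h : ∀ (v w : Fin n → ℝ) (x y : ℝ), v ≠ 0 → w ≠ 0 → A *ᵥ v = x • v → B *ᵥ w = y • w →
      v ⬝ᵥ w ≠ 0 → x = y) : A = B := by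
  obtain ⟨U, d, hU, hAU⟩ := exists_orthogonal_diagonalization hA
  obtain ⟨V, e, hV, hBV⟩ := exists_orthogonal_diagonalization hB
  have hU' := mul_eq_one_comm.1 hU
  have hm : diagonal d * (Uᵀ * V) = Uᵀ * V * diagonal e := by
    ext i j
    rw [Matrix.diagonal_mul, Matrix.mul_diagonal, mul_comm]
    by_cases h0 : (Uᵀ * V) i j = 0
    · rw [h0, zero_mul, zero_mul]
    · have h1 : Uᵀ i ⬝ᵥ Vᵀ j ≠ 0 := h0
      rw [h (Uᵀ i) (Vᵀ j) (d i) (e j) (fun h => h1 (by rw [h, zero_dotProduct]))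
        (fun h => h1 (by rw [h, dotProduct_zero])) (mulVec_eq_of_mul_eq_mul_diagonal hAU i)
        (mulVec_eq_of_mul_eq_mul_diagonal hBV j) h1]
  have e : A * V = B * V := by
    calc A * V = A * U * Uᵀ * V := by rw [mul_assoc A, hU', mul_one]
      _ = U * (diagonal d * (Uᵀ * V)) := by rw [hAU]; simp only [mul_assoc]
      _ = U * Uᵀ * (V * diagonal e) := by rw [hm]; simp only [mul_assoc]
      _ = B * V := by rw [hU', one_mul, hBV]
  calc A = A * V * Vᵀ := by rw [mul_assoc, mul_eq_one_comm.1 hV, mul_one]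
    _ = B := by rw [e, mul_assoc, mul_eq_one_comm.1 hV, mul_one]

/-! ### Eigenvectors of tangent vectors -/

theorem mulVec_mulVec_self {J : Matrix (Fin n) (Fin n) ℝ} (hJ : J * J = 1) (v : Fin n → ℝ) :
    J *ᵥ (J *ᵥ v) = v := by
  rw [Matrix.mulVec_mulVec, hJ, Matrix.one_mulVec]

theorem mulVec_reflected {J Δ : Matrix (Fin n) (Fin n) ℝ} (h : Δ * J = -(J * Δ)) {v : Fin n → ℝ}
    {l : ℝ} (hv : Δ *ᵥ v = l • v) : Δ *ᵥ (J *ᵥ v) = -(l • (J *ᵥ v)) := by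
  rw [Matrix.mulVec_mulVec, h, Matrix.neg_mulVec, ← Matrix.mulVec_mulVec, hv, Matrix.mulVec_smul]

/-- For `Δ` anticommuting with the involution `J`, the matrix `exp (cΔJ)` rotates the plane spanned
by an eigenvector `v` of `Δ` and `J v`. -/
theorem exp_smul_mulVec {J Δ : Matrix (Fin n) (Fin n) ℝ} (hJ : J * J = 1)
    (h : Δ * J = -(J * Δ)) {v : Fin n → ℝ} {l : ℝ} (hv : Δ *ᵥ v = l • v) (c : ℝ) :
    NormedSpace.exp (c • (Δ * J)) *ᵥ v =
      Real.cos (c * l) • v - Real.sin (c * l) • (J *ᵥ v) := by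
  have h1 : (c • (Δ * J)) *ᵥ v = -((c * l) • (J *ᵥ v)) := by
    rw [Matrix.smul_mulVec, ← Matrix.mulVec_mulVec, mulVec_reflected h hv, smul_neg, mul_smul]
  have h2 : (c • (Δ * J)) *ᵥ (J *ᵥ v) = (c * l) • v := by
    rw [Matrix.smul_mulVec, ← Matrix.mulVec_mulVec, mulVec_mulVec_self hJ, hv, mul_smul]
  have key := exp_mul_of_rotation (Ω := c • (Δ * J)) (A := vecMulVec v 1)
    (B := vecMulVec (J *ᵥ v) 1) (l := c * l)
    (by rw [Matrix.mul_vecMulVec, h1, Matrix.neg_vecMulVec, Matrix.smul_vecMulVec])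
    (by rw [Matrix.mul_vecMulVec, h2, Matrix.smul_vecMulVec])
  rw [Matrix.mul_vecMulVec] at key
  ext i
  simpa [Matrix.vecMulVec_apply] using congrFun (congrFun key i) i

/-- Twice the cosine of `2Δ`, read off from the endpoint reflection `X`. -/
theorem mulVec_cos_part {J Δ : Matrix (Fin n) (Fin n) ℝ} (hJ : J * J = 1)
    (h : Δ * J = -(J * Δ)) (hX : X = NormedSpace.exp ((2 : ℝ) • (Δ * J)) * J) {v : Fin n → ℝ}
    {l : ℝ} (hv : Δ *ᵥ v = l • v) :
    (X * J + J * X) *ᵥ v = (2 * Real.cos (2 * l)) • v := by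
  have hv' : Δ *ᵥ (J *ᵥ v) = (-l) • (J *ᵥ v) := by rw [mulVec_reflected h hv, neg_smul]
  rw [hX, mul_assoc, hJ, mul_one, Matrix.add_mulVec, exp_smul_mulVec hJ h hv,
    ← Matrix.mulVec_mulVec, ← Matrix.mulVec_mulVec, exp_smul_mulVec hJ h hv', Matrix.mulVec_sub,
    Matrix.mulVec_smul, Matrix.mulVec_smul, mulVec_mulVec_self hJ]
  simp only [mul_neg, Real.cos_neg, Real.sin_neg]
  module

/-- Twice the sine of `2Δ`, read off from the endpoint reflection `X`. -/
theorem mulVec_sin_part {J Δ : Matrix (Fin n) (Fin n) ℝ} (hJ : J * J = 1)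
    (h : Δ * J = -(J * Δ)) (hX : X = NormedSpace.exp ((2 : ℝ) • (Δ * J)) * J) {v : Fin n → ℝ}
    {l : ℝ} (hv : Δ *ᵥ v = l • v) :
    (X - J * X * J) *ᵥ v = (2 * Real.sin (2 * l)) • v := by
  have hv' : Δ *ᵥ (J *ᵥ v) = (-l) • (J *ᵥ v) := by rw [mulVec_reflected h hv, neg_smul]
  rw [hX, mul_assoc J, mul_assoc _ J J, hJ, mul_one, Matrix.sub_mulVec,
    ← Matrix.mulVec_mulVec, ← Matrix.mulVec_mulVec, exp_smul_mulVec hJ h hv,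
    exp_smul_mulVec hJ h hv', Matrix.mulVec_sub,
    Matrix.mulVec_smul, Matrix.mulVec_smul, mulVec_mulVec_self hJ]
  simp only [mul_neg, Real.cos_neg, Real.sin_neg]
  module

theorem eq_of_cos_eq_of_sin_eq {x y : ℝ} (hx : |x| < Real.pi / 2) (hy : |y| ≤ Real.pi / 2)
    (hc : Real.cos (2 * x) = Real.cos (2 * y)) (hs : Real.sin (2 * x) = Real.sin (2 * y)) :
    x = y := by
  have h1 : Real.cos (2 * x - 2 * y) = 1 := by
    rw [Real.cos_sub, hc, hs, ← sq, ← sq, Real.cos_sq_add_sin_sq]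
  have hx' := abs_lt.1 hx
  have hy' := abs_le.1 hy
  have := (Real.cos_eq_one_iff_of_lt_of_lt (by linarith) (by linarith)).1 h1
  linarith

/-- Two tangent vectors whose geodesics have the same endpoint coincide when the eigenvalues of one
are less than `π/2` and those of the other at most `π/2` in absolute value. -/
theorem tangent_eq_of_exp_eq {J Δ Δ' : Matrix (Fin n) (Fin n) ℝ} (hJt : Jᵀ = J) (hJ : J * J = 1)
    (hΔt : Δᵀ = Δ) (hΔ : Δ * J = -(J * Δ)) (hΔt' : Δ'ᵀ = Δ') (hΔ' : Δ' * J = -(J * Δ'))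
    (hXt : Xᵀ = X) (hX : X = NormedSpace.exp ((2 : ℝ) • (Δ * J)) * J)
    (hX' : X = NormedSpace.exp ((2 : ℝ) • (Δ' * J)) * J)
    (hb : ∀ (v : Fin n → ℝ) (l : ℝ), v ≠ 0 → Δ *ᵥ v = l • v → |l| < Real.pi / 2)
    (hb' : ∀ (v : Fin n → ℝ) (l : ℝ), v ≠ 0 → Δ' *ᵥ v = l • v → |l| ≤ Real.pi / 2) :
    Δ = Δ' := by
  refine eq_of_eigenvectors hΔt hΔt' fun v w x y hv0 hw0 hv hw hvw => ?_
  refine eq_of_cos_eq_of_sin_eq (hb v x hv0 hv) (hb' w y hw0 hw) ?_ ?_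
  · have := eigenvalue_eq_of_dotProduct_ne_zero (X := X * J + J * X)
      (by rw [transpose_add, transpose_mul, transpose_mul, hJt, hXt, add_comm])
      (mulVec_cos_part hJ hΔ hX hv) (mulVec_cos_part hJ hΔ' hX' hw) hvw
    linarith
  · have := eigenvalue_eq_of_dotProduct_ne_zero (X := X - J * X * J)
      (by simp only [transpose_sub, transpose_mul, hJt, hXt, mul_assoc])
      (mulVec_sin_part hJ hΔ hX hv) (mulVec_sin_part hJ hΔ' hX' hw) hvw
    linarith

/-! ### Shortening geodesics -/

/-- A full turn: `exp (-2πK) = 1` for every `K` with `K³ = -K`. -/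
theorem exp_two_pi_eq_one {K : Matrix (Fin n) (Fin n) ℝ} (hK : K * (K * K) = -K) :
    NormedSpace.exp (-((2 * Real.pi) • K)) = 1 := by
  have h1 := exp_mul_of_rotation (Ω := -((2 * Real.pi) • K)) (A := K) (B := K * K)
    (l := 2 * Real.pi) (by rw [neg_mul, smul_mul_assoc])
    (by rw [neg_mul, smul_mul_assoc, hK, smul_neg, neg_neg])
  have h2 := exp_mul_of_rotation (Ω := -((2 * Real.pi) • K)) (A := 1 + K * K) (B := 0)
    (l := 0) (by rw [neg_mul, smul_mul_assoc, mul_add, hK, mul_one, add_neg_cancel]; simp)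
    (by simp)
  rw [Real.cos_two_pi, Real.sin_two_pi, one_smul, zero_smul, sub_zero] at h1
  rw [Real.cos_zero, one_smul, smul_zero, sub_zero, mul_add, mul_one, ← mul_assoc, h1] at h2
  exact add_right_cancel h2

theorem frobInner_self_nonneg (X : Matrix (Fin n) (Fin n) ℝ) : 0 ≤ frobInner X X := by
  rw [frobInner, Matrix.trace]
  exact Finset.sum_nonneg fun i _ => by
    rw [Matrix.diag_apply, Matrix.mul_apply]
    exact Finset.sum_nonneg fun j _ => mul_self_nonneg _

/-- A tangent vector with an eigenvalue larger than `π/2` is not minimizing: turning back by `π` in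
the plane of the eigenvector `v` and its reflection gives a shorter tangent vector with the same
endpoint. -/
theorem exists_shorter {J Δ : Matrix (Fin n) (Fin n) ℝ} (hJt : Jᵀ = J) (hJ : J * J = 1)
    (hΔt : Δᵀ = Δ) (hΔ : Δ * J = -(J * Δ)) {v : Fin n → ℝ} {l : ℝ} (hv1 : v ⬝ᵥ v = 1)
    (hv : Δ *ᵥ v = l • v) (hl : Real.pi / 2 < l) :
    ∃ Δ' : Matrix (Fin n) (Fin n) ℝ, Δ'ᵀ = Δ' ∧ Δ' * J = -(J * Δ') ∧
      NormedSpace.exp ((2 : ℝ) • (Δ' * J)) = NormedSpace.exp ((2 : ℝ) • (Δ * J)) ∧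
      frobInner Δ' Δ' < frobInner Δ Δ := by
  have hpi := Real.pi_pos
  set w := J *ᵥ v with hw
  have hJw : J *ᵥ w = v := mulVec_mulVec_self hJ v
  have hΔw : Δ *ᵥ w = (-l) • w := by rw [mulVec_reflected hΔ hv, neg_smul]
  have hsymm : ∀ x y : Fin n → ℝ, (J *ᵥ x) ⬝ᵥ y = x ⬝ᵥ (J *ᵥ y) := fun x y => by
    rw [Matrix.dotProduct_mulVec, ← Matrix.mulVec_transpose, hJt]
  have hw1 : w ⬝ᵥ w = 1 := by rw [hw, hsymm, mulVec_mulVec_self hJ, hv1]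
  have hvw : v ⬝ᵥ w = 0 := by
    by_contra h
    have := eigenvalue_eq_of_dotProduct_ne_zero hΔt hv hΔw h
    linarith
  have hwv : w ⬝ᵥ v = 0 := by rw [dotProduct_comm, hvw]
  have hvΔ : v ᵥ* Δ = l • v := by rw [← Matrix.mulVec_transpose, hΔt, hv]
  have hwΔ : w ᵥ* Δ = (-l) • w := by rw [← Matrix.mulVec_transpose, hΔt, hΔw]
  have hvJ : v ᵥ* J = w := by rw [← Matrix.mulVec_transpose, hJt]
  have hwJ : w ᵥ* J = v := by rw [← Matrix.mulVec_transpose, hJt, hJw]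
  set E := vecMulVec v v - vecMulVec w w with hE
  have hEt : Eᵀ = E := by simp [hE, Matrix.transpose_vecMulVec]
  have hEJ : E * J = vecMulVec v w - vecMulVec w v := by
    rw [hE, sub_mul, Matrix.vecMulVec_mul, Matrix.vecMulVec_mul, hvJ, hwJ]
  have hJE : J * E = -(E * J) := by
    rw [hEJ, hE, mul_sub, Matrix.mul_vecMulVec, Matrix.mul_vecMulVec, hJw, ← hw]
    abel
  have hΔE : Δ * E = l • (vecMulVec v v + vecMulVec w w) := by
    rw [hE, mul_sub, Matrix.mul_vecMulVec, Matrix.mul_vecMulVec, hv, hΔw]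
    simp only [Matrix.smul_vecMulVec]
    module
  have hEΔ : E * Δ = Δ * E := by
    rw [hΔE, hE, sub_mul, Matrix.vecMulVec_mul, Matrix.vecMulVec_mul, hvΔ, hwΔ]
    simp only [Matrix.vecMulVec_smul]
    module
  have hEE : E * E = vecMulVec v v + vecMulVec w w := by
    simp only [hE, mul_sub, sub_mul, Matrix.vecMulVec_mul_vecMulVec, hv1, hw1, hvw, hwv]
    simp
  have hEEE : E * E * E = E := by
    rw [hEE]
    simp only [hE, mul_sub, add_mul, Matrix.vecMulVec_mul_vecMulVec, hv1, hw1, hvw, hwv]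
    simp
  have hKK : E * J * (E * J) = -(E * E) := by
    rw [mul_assoc, ← mul_assoc J, hJE, neg_mul, mul_assoc E J, hJ, mul_one, mul_neg]
  have hJEE : J * (E * E) = E * E * J := by
    rw [← mul_assoc, hJE, neg_mul, mul_assoc, hJE, mul_neg, neg_neg, mul_assoc]
  have hKKK : E * J * (E * J * (E * J)) = -(E * J) := by
    rw [hKK, mul_neg, mul_assoc, hJEE, ← mul_assoc, ← mul_assoc, hEEE]
  have hcomm : Commute (Δ * J) (E * J) := by
    have h1 : Δ * J * (E * J) = -(Δ * E) := by
      rw [mul_assoc, ← mul_assoc J, hJE, neg_mul, mul_assoc E J, hJ, mul_one, mul_neg]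
    have h2 : E * J * (Δ * J) = -(E * Δ) := by
      rw [mul_assoc, hΔ, mul_neg, ← mul_assoc J, hJ, one_mul, mul_neg]
    rw [Commute, SemiconjBy, h1, h2, hEΔ]
  refine ⟨Δ - Real.pi • E, by rw [transpose_sub, transpose_smul, hΔt, hEt], ?_, ?_, ?_⟩
  · rw [sub_mul, mul_sub, smul_mul_assoc, mul_smul_comm, hJE, hΔ]
    module
  · have e : (2 : ℝ) • ((Δ - Real.pi • E) * J) =
        (2 : ℝ) • (Δ * J) + -((2 * Real.pi) • (E * J)) := by
      rw [sub_mul, smul_mul_assoc]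
      module
    rw [e, Matrix.exp_add_of_commute _ _ ((hcomm.smul_left _).smul_right _).neg_right,
      exp_two_pi_eq_one hKKK, mul_one]
  · have htr : (vecMulVec v v + vecMulVec w w).trace = 2 := by
      rw [trace_add, Matrix.trace_vecMulVec, Matrix.trace_vecMulVec, hv1, hw1]
      norm_num
    have e : (Δ - Real.pi • E) * (Δ - Real.pi • E) =
        Δ * Δ - (2 * Real.pi) • (Δ * E) + (Real.pi * Real.pi) • (E * E) := by
      simp only [sub_mul, mul_sub, smul_mul_assoc, mul_smul_comm, hEΔ]
      module
    rw [frobInner, frobInner, transpose_sub, transpose_smul, hΔt, hEt, e, trace_add, trace_sub,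
      trace_smul, trace_smul, hΔE, hEE, trace_smul, htr]
    simp only [smul_eq_mul]
    nlinarith

end

section

variable {n p : ℕ} {P Q Δ Δ' O : Matrix (Fin n) (Fin n) ℝ}

/-! ### Minimizing geodesics and the cut locus -/

/-- The eigenvalues of a minimizing tangent vector are at most `π/2` in absolute value: minimizing
geodesics have principal angles at most `π/2`. -/
theorem IsMinimizing.abs_eigenvalue_le (hP : P ∈ Gr n p) (h : IsMinimizing p P Q Δ)
    {v : Fin n → ℝ} {l : ℝ} (hv0 : v ≠ 0) (hv : Δ *ᵥ v = l • v) : |l| ≤ Real.pi / 2 := by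
  have hJ := refl_mul_self hP.2.1
  have hJt := transpose_refl hP.1
  obtain ⟨hT, hQ⟩ := (isExp_iff hP).1 h.1
  obtain ⟨hΔt, hΔ⟩ := mem_tangent_iff.1 hT
  have key : ∀ (u : Fin n → ℝ) (m : ℝ), u ≠ 0 → Δ *ᵥ u = m • u → m ≤ Real.pi / 2 := by
    intro u m hu0 hu
    by_contra! hm
    have hpos : 0 < u ⬝ᵥ u := lt_of_le_of_ne (Finset.sum_nonneg fun i _ => mul_self_nonneg _)
      fun h => hu0 (dotProduct_self_eq_zero.1 h.symm)
    have hs : Real.sqrt (u ⬝ᵥ u) ≠ 0 := (Real.sqrt_pos.2 hpos).ne'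
    obtain ⟨Δ', hΔt', hΔ', he, hlt⟩ := exists_shorter hJt hJ hΔt hΔ
      (v := (Real.sqrt (u ⬝ᵥ u))⁻¹ • u) (l := m)
      (by
        rw [smul_dotProduct, dotProduct_smul, smul_eq_mul, smul_eq_mul]
        nth_rewrite 3 [← Real.mul_self_sqrt hpos.le]
        field_simp)
      (by rw [Matrix.mulVec_smul, hu, smul_comm]) hm
    have := h.2 Δ' ((isExp_iff hP).2 ⟨mem_tangent_iff.2 ⟨hΔt', hΔ'⟩, by rw [he, hQ]⟩)
    exact absurd this (not_le.2 (Real.sqrt_lt_sqrt (frobInner_self_nonneg _) hlt))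
  -- `J v` is an eigenvector for the eigenvalue `-l`
  refine abs_le'.2 ⟨key v l hv0 hv, key (refl P *ᵥ v) (-l) (fun h0 => hv0 ?_) ?_⟩
  · rw [← mulVec_mulVec_self hJ v, h0, Matrix.mulVec_zero]
  · rw [mulVec_reflected hΔ hv, neg_smul]

/-- Off the cut locus the minimizing geodesic is unique. -/
theorem IsMinimizing.unique (hP : P ∈ Gr n p) (hQ : Q ∈ Gr n p) (hc : Q ∉ cutLocus p P)
    (h : IsMinimizing p P Q Δ) (h' : IsMinimizing p P Q Δ') : Δ = Δ' := by
  have hJ := refl_mul_self hP.2.1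
  have hJt := transpose_refl hP.1
  obtain ⟨D, hD, t, ht, Q', hQ'⟩ : ∃ Δ, IsMinimizing p P Q Δ ∧
      ∃ t : ℝ, 1 < t ∧ ∃ Q', IsMinimizing p P Q' (t • Δ) := by
    by_contra hn
    exact hc ⟨hQ, hn⟩
  have hDb : ∀ (v : Fin n → ℝ) (l : ℝ), v ≠ 0 → D *ᵥ v = l • v → |l| < Real.pi / 2 := by
    intro v l hv0 hv
    have h1 := hQ'.abs_eigenvalue_le hP hv0 (l := t * l)
      (by rw [Matrix.smul_mulVec, hv, mul_smul])
    rw [abs_mul, abs_of_pos (by linarith)] at h1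
    rcases (abs_nonneg l).eq_or_lt with h0 | h0
    · rw [← h0]; positivity
    · nlinarith
  -- the velocity that stays minimizing beyond `Q` equals every minimizing one
  have key : ∀ D', IsMinimizing p P Q D' → D = D' := by
    intro D' hD'
    obtain ⟨hT, hX⟩ := (isExp_iff hP).1 hD.1
    obtain ⟨hT', hX'⟩ := (isExp_iff hP).1 hD'.1
    obtain ⟨h1, h2⟩ := mem_tangent_iff.1 hT
    obtain ⟨h1', h2'⟩ := mem_tangent_iff.1 hT'
    exact tangent_eq_of_exp_eq hJt hJ h1 h2 h1' h2' (transpose_refl hQ.1) hX hX' hDb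
      fun v l hv0 hv => hD'.abs_eigenvalue_le hP hv0 hv
  rw [← key Δ h, key Δ' h']

theorem isMinimizing_log (h : ∃ Δ, IsMinimizing p P Q Δ) : IsMinimizing p P Q (log p P Q) :=
  Classical.epsilon_spec h

theorem isMinimizing_log_of_notMem (hQ : Q ∈ Gr n p) (hc : Q ∉ cutLocus p P) :
    IsMinimizing p P Q (log p P Q) := by
  refine isMinimizing_log ?_
  by_contra hn
  exact hc ⟨hQ, fun ⟨Δ, h, _⟩ => hn ⟨Δ, h⟩⟩

/-! ### Isometries fixing the base point -/

theorem frobInner_conj (hO : Oᵀ * O = 1) (X : Matrix (Fin n) (Fin n) ℝ) :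
    frobInner (O * X * Oᵀ) (O * X * Oᵀ) = frobInner X X := by
  have e : (O * X * Oᵀ)ᵀ * (O * X * Oᵀ) = O * (Xᵀ * (Oᵀ * O) * X) * Oᵀ := by
    simp only [transpose_mul, transpose_transpose, mul_assoc]
  rw [frobInner, frobInner, e, trace_mul_comm, ← mul_assoc, hO, mul_one, one_mul]

theorem exp_conj_orthogonal (hO : Oᵀ * O = 1) (X : Matrix (Fin n) (Fin n) ℝ) :
    NormedSpace.exp (O * X * Oᵀ) = O * NormedSpace.exp X * Oᵀ := by
  rw [← Matrix.inv_eq_left_inv hO]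
  exact Matrix.exp_conj O X (IsUnit.of_mul_eq_one _ (mul_eq_one_comm.1 hO))

theorem conj_mul_conj (hO : Oᵀ * O = 1) (X Y : Matrix (Fin n) (Fin n) ℝ) :
    O * X * Oᵀ * (O * Y * Oᵀ) = O * (X * Y) * Oᵀ := by
  calc O * X * Oᵀ * (O * Y * Oᵀ) = O * X * (Oᵀ * O) * Y * Oᵀ := by simp only [mul_assoc]
    _ = _ := by rw [hO, mul_one, mul_assoc O]

theorem conj_eq_self (hO : Oᵀ * O = 1) (h : O * P = P * O) : O * P * Oᵀ = P := by
  rw [h, mul_assoc, mul_eq_one_comm.1 hO, mul_one]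

theorem transpose_commute (hO : Oᵀ * O = 1) (h : O * P = P * O) : Oᵀ * P = P * Oᵀ := by
  calc Oᵀ * P = Oᵀ * (O * P * Oᵀ) := by rw [conj_eq_self hO h]
    _ = P * Oᵀ := by rw [← mul_assoc, ← mul_assoc, hO, one_mul]

theorem transpose_conj_conj (hO : Oᵀ * O = 1) (X : Matrix (Fin n) (Fin n) ℝ) :
    Oᵀ * (O * X * Oᵀ) * Oᵀᵀ = X := by
  calc Oᵀ * (O * X * Oᵀ) * Oᵀᵀ = Oᵀ * O * X * (Oᵀ * O) := by
        simp only [transpose_transpose, mul_assoc]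
    _ = X := by rw [hO, one_mul, mul_one]

theorem conj_mem_tangent (hO : Oᵀ * O = 1) (hOP : O * P = P * O) (h : Δ ∈ tangent P) :
    O * Δ * Oᵀ ∈ tangent P := by
  refine ⟨by simp only [transpose_mul, transpose_transpose, h.1, mul_assoc], ?_⟩
  calc O * Δ * Oᵀ * P + P * (O * Δ * Oᵀ)
      = O * Δ * Oᵀ * (O * P * Oᵀ) + O * P * Oᵀ * (O * Δ * Oᵀ) := by rw [conj_eq_self hO hOP]
    _ = O * (Δ * P + P * Δ) * Oᵀ := by
      rw [conj_mul_conj hO, conj_mul_conj hO, mul_add, add_mul]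
    _ = _ := by rw [h.2]

theorem comm_conj (hO : Oᵀ * O = 1) (hOP : O * P = P * O) (X : Matrix (Fin n) (Fin n) ℝ) :
    comm (O * X * Oᵀ) P = O * comm X P * Oᵀ := by
  conv_lhs => rw [← conj_eq_self hO hOP]
  rw [comm, conj_mul_conj hO, conj_mul_conj hO, comm, mul_sub, sub_mul]

theorem IsExp.conj (hP : P ∈ Gr n p) (hO : Oᵀ * O = 1) (hOP : O * P = P * O)
    (h : IsExp p P Δ Q) : IsExp p P (O * Δ * Oᵀ) (O * Q * Oᵀ) := by
  obtain ⟨hT, hQ⟩ := h.tangent_and_eq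
  have := isExp_of_tangent hP (conj_mem_tangent hO hOP hT)
  have e : -(O * comm Δ P * Oᵀ) = O * (-comm Δ P) * Oᵀ := by rw [mul_neg, neg_mul]
  rw [comm_conj hO hOP, e, exp_conj_orthogonal hO, exp_conj_orthogonal hO] at this
  convert this using 1
  conv_rhs => rw [← conj_eq_self hO hOP, conj_mul_conj hO, conj_mul_conj hO, conj_eq_self hO hOP]
  rw [hQ]

theorem IsMinimizing.conj (hP : P ∈ Gr n p) (hO : Oᵀ * O = 1) (hOP : O * P = P * O)
    (h : IsMinimizing p P Q Δ) : IsMinimizing p P (O * Q * Oᵀ) (O * Δ * Oᵀ) := by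
  refine ⟨h.1.conj hP hO hOP, fun D hD => ?_⟩
  have hO' : Oᵀᵀ * Oᵀ = 1 := by rw [transpose_transpose, mul_eq_one_comm.1 hO]
  have := hD.conj hP hO' (transpose_commute hO hOP)
  rw [transpose_conj_conj hO] at this
  have := h.2 _ this
  rwa [frobNorm, frobNorm, frobInner_conj hO', ← frobInner_conj hO Δ] at this

theorem conj_notMem_cutLocus (hP : P ∈ Gr n p) (hO : Oᵀ * O = 1) (hOP : O * P = P * O)
    (hQ : Q ∈ Gr n p) (hc : Q ∉ cutLocus p P) : O * Q * Oᵀ ∉ cutLocus p P := by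
  refine fun hc' => hc ⟨hQ, fun ⟨Δ, hΔ, t, ht, Q', hQ'⟩ => hc'.2
    ⟨O * Δ * Oᵀ, hΔ.conj hP hO hOP, t, ht, O * Q' * Oᵀ, ?_⟩⟩
  have := hQ'.conj hP hO hOP
  rwa [mul_smul_comm, smul_mul_assoc] at this

/-- The logarithm is equivariant under isometries fixing the base point, off the cut locus. -/
theorem log_conj (hP : P ∈ Gr n p) (hO : Oᵀ * O = 1) (hOP : O * P = P * O)
    (hQ : Q ∈ Gr n p) (hc : Q ∉ cutLocus p P) : log p P (O * Q * Oᵀ) = O * log p P Q * Oᵀ :=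
  IsMinimizing.unique hP (conj_mem_Gr hO hQ) (conj_notMem_cutLocus hP hO hOP hQ hc)
    (isMinimizing_log_of_notMem (conj_mem_Gr hO hQ) (conj_notMem_cutLocus hP hO hOP hQ hc))
    ((isMinimizing_log_of_notMem hQ hc).conj hP hO hOP)

/-- The length of a minimizing geodesic is invariant under isometries fixing the base point. -/
theorem frobNorm_log_conj (hP : P ∈ Gr n p) (hO : Oᵀ * O = 1) (hOP : O * P = P * O)
    (hQ : ∃ Δ, IsMinimizing p P Q Δ) :
    frobNorm (log p P (O * Q * Oᵀ)) = frobNorm (log p P Q) := by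
  have h := (isMinimizing_log hQ).conj hP hO hOP
  have h' := isMinimizing_log ⟨_, h⟩
  have e : frobNorm (O * log p P Q * Oᵀ) = frobNorm (log p P Q) := by
    rw [frobNorm, frobInner_conj hO, frobNorm]
  rw [← e]
  exact le_antisymm (h'.2 _ h.1) (h.2 _ h'.1)

theorem refl_commute (hP : P * P = P) : refl P * P = P * refl P := by
  simp [refl, mul_sub, sub_mul, hP]

theorem transpose_refl_mul_refl (hP : P ∈ Gr n p) : (refl P)ᵀ * refl P = 1 := by
  rw [transpose_refl hP.1, refl_mul_self hP.2.1]

theorem refl_conj_tangent (hP : P ∈ Gr n p) (h : Δ ∈ tangent P) :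
    refl P * Δ * (refl P)ᵀ = -Δ := by
  rw [transpose_refl hP.1, mul_assoc, (mem_tangent_iff.1 h).2, mul_neg, ← mul_assoc,
    refl_mul_self hP.2.1, one_mul]

/-! ### The gyrogroup operations -/

theorem log_mem_tangent (hP : P ∈ Gr n p) (hQ : Q ∈ Gr n p) (hc : Q ∉ cutLocus p P) :
    log p P Q ∈ tangent P :=
  ((isExp_iff hP).1 (isMinimizing_log_of_notMem hQ hc).1).1

/-- Off the cut locus the gyroinverse is the geodesic symmetry at the base point, that is,
conjugation by the reflection in the base point. -/
theorem gneg_eq (hp : p ≤ n) (hQ : Q ∈ Gr n p) (hc : Q ∉ cutLocus p (base n p)) :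
    gneg p Q = refl (base n p) * Q * (refl (base n p))ᵀ := by
  have hP := base_mem_Gr hp
  have h := (isMinimizing_log_of_notMem hQ hc).1.conj hP (transpose_refl_mul_refl hP)
    (refl_commute hP.2.1)
  rw [refl_conj_tangent hP (log_mem_tangent hP hQ hc)] at h
  rw [h.tangent_and_eq.2, gneg, gsmul, neg_one_smul]

theorem gneg_mem_Gr (hp : p ≤ n) (hQ : Q ∈ Gr n p) (hc : Q ∉ cutLocus p (base n p)) :
    gneg p Q ∈ Gr n p := by
  rw [gneg_eq hp hQ hc]
  exact conj_mem_Gr (transpose_refl_mul_refl (base_mem_Gr hp)) hQ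

theorem gneg_notMem_cutLocus (hp : p ≤ n) (hQ : Q ∈ Gr n p) (hc : Q ∉ cutLocus p (base n p)) :
    gneg p Q ∉ cutLocus p (base n p) := by
  have hP := base_mem_Gr hp
  rw [gneg_eq hp hQ hc]
  exact conj_notMem_cutLocus hP (transpose_refl_mul_refl hP) (refl_commute hP.2.1) hQ hc

theorem log_gneg (hp : p ≤ n) (hQ : Q ∈ Gr n p) (hc : Q ∉ cutLocus p (base n p)) :
    log p (base n p) (gneg p Q) = -log p (base n p) Q := by
  have hP := base_mem_Gr hp
  rw [gneg_eq hp hQ hc, log_conj hP (transpose_refl_mul_refl hP) (refl_commute hP.2.1) hQ hc,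
    refl_conj_tangent hP (log_mem_tangent hP hQ hc)]

theorem gneg_conj (hp : p ≤ n) (hO : Oᵀ * O = 1) (hOP : O * base n p = base n p * O)
    (hQ : Q ∈ Gr n p) (hc : Q ∉ cutLocus p (base n p)) :
    gneg p (O * Q * Oᵀ) = O * gneg p Q * Oᵀ := by
  have hP := base_mem_Gr hp
  have hOJ : O * refl (base n p) = refl (base n p) * O := by
    simp [refl, mul_sub, sub_mul, hOP]
  have hOJ' := transpose_commute hO hOJ
  rw [gneg_eq hp hQ hc, gneg_eq hp (conj_mem_Gr hO hQ) (conj_notMem_cutLocus hP hO hOP hQ hc),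
    transpose_refl hP.1]
  calc _ = (refl (base n p) * O) * Q * (Oᵀ * refl (base n p)) := by simp only [mul_assoc]
    _ = _ := by rw [hOJ', ← hOJ]; simp only [mul_assoc]

/-- The orthogonal matrix `exp [Log(P), I]` by which `P ⊕ ·` conjugates. -/
def gtrans (p : ℕ) (P : Matrix (Fin n) (Fin n) ℝ) : Matrix (Fin n) (Fin n) ℝ :=
  NormedSpace.exp (comm (log p (base n p) P) (base n p))

theorem gtrans_transpose (hp : p ≤ n) (hP : P ∈ Gr n p) (hc : P ∉ cutLocus p (base n p)) :
    (gtrans p P)ᵀ = NormedSpace.exp (-comm (log p (base n p) P) (base n p)) :=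
  transpose_exp_of_skew (transpose_comm (base_mem_Gr hp).1
    (log_mem_tangent (base_mem_Gr hp) hP hc).1)

theorem gtrans_transpose_mul_self (hp : p ≤ n) (hP : P ∈ Gr n p)
    (hc : P ∉ cutLocus p (base n p)) : (gtrans p P)ᵀ * gtrans p P = 1 := by
  rw [gtrans_transpose hp hP hc, gtrans, exp_neg_mul_exp]

theorem gadd_eq (hp : p ≤ n) (hP : P ∈ Gr n p) (hc : P ∉ cutLocus p (base n p))
    (Q : Matrix (Fin n) (Fin n) ℝ) : gadd p P Q = gtrans p P * Q * (gtrans p P)ᵀ := by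
  rw [gtrans_transpose hp hP hc, gtrans, gadd]

theorem gadd_mem_Gr (hp : p ≤ n) (hP : P ∈ Gr n p) (hc : P ∉ cutLocus p (base n p))
    (hQ : Q ∈ Gr n p) : gadd p P Q ∈ Gr n p := by
  rw [gadd_eq hp hP hc]
  exact conj_mem_Gr (gtrans_transpose_mul_self hp hP hc) hQ

theorem gadd_base (hP : P ∈ Gr n p) (hc : P ∉ cutLocus p (base n p)) :
    gadd p P (base n p) = P :=
  ((isMinimizing_log_of_notMem hP hc).1.tangent_and_eq.2).symm

theorem gtrans_gneg (hp : p ≤ n) (hP : P ∈ Gr n p) (hc : P ∉ cutLocus p (base n p)) :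
    gtrans p (gneg p P) = (gtrans p P)ᵀ := by
  rw [gtrans_transpose hp hP hc, gtrans, log_gneg hp hP hc]
  congr 1
  simp only [comm, neg_mul, mul_neg, neg_sub]
  abel

theorem gtrans_conj (hp : p ≤ n) (hO : Oᵀ * O = 1) (hOP : O * base n p = base n p * O)
    (hQ : Q ∈ Gr n p) (hc : Q ∉ cutLocus p (base n p)) :
    gtrans p (O * Q * Oᵀ) = O * gtrans p Q * Oᵀ := by
  rw [gtrans, log_conj (base_mem_Gr hp) hO hOP hQ hc, comm_conj hO hOP, exp_conj_orthogonal hO,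
    gtrans]

/-- `gyr[P, Q]` is the conjugation by an orthogonal matrix fixing the base point. -/
theorem exists_gyr_eq_conj (hp : p ≤ n) (hP : P ∈ Gr n p) (hQ : Q ∈ Gr n p)
    (hPc : P ∉ cutLocus p (base n p)) (hQc : Q ∉ cutLocus p (base n p))
    (hPQc : gadd p P Q ∉ cutLocus p (base n p)) :
    ∃ O : Matrix (Fin n) (Fin n) ℝ, Oᵀ * O = 1 ∧ O * base n p = base n p * O ∧
      ∀ R, gyr p P Q R = O * R * Oᵀ := by
  have hPQ := gadd_mem_Gr hp hP hPc hQ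
  set X := gadd p P Q with hX
  have hP1 := gtrans_transpose_mul_self hp hP hPc
  have hQ1 := gtrans_transpose_mul_self hp hQ hQc
  have hX1 := gtrans_transpose_mul_self hp hPQ hPQc
  have hgyr : ∀ R, gyr p P Q R = ((gtrans p X)ᵀ * gtrans p P * gtrans p Q) * R *
      ((gtrans p X)ᵀ * gtrans p P * gtrans p Q)ᵀ := by
    intro R
    rw [gyr, gadd_eq hp (gneg_mem_Gr hp hPQ hPQc) (gneg_notMem_cutLocus hp hPQ hPQc),
      gtrans_gneg hp hPQ hPQc, gadd_eq hp hP hPc, gadd_eq hp hQ hQc]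
    simp only [transpose_mul, mul_assoc]
  have hO : ((gtrans p X)ᵀ * gtrans p P * gtrans p Q)ᵀ *
      ((gtrans p X)ᵀ * gtrans p P * gtrans p Q) = 1 := by
    calc _ = (gtrans p Q)ᵀ * ((gtrans p P)ᵀ * (gtrans p X * (gtrans p X)ᵀ) * gtrans p P) *
          gtrans p Q := by simp only [transpose_mul, transpose_transpose, mul_assoc]
      _ = 1 := by rw [mul_eq_one_comm.1 hX1, mul_one, hP1, mul_one, hQ1]
  refine ⟨_, hO, ?_, hgyr⟩
  -- `gyr[P, Q]` sends the base point to `⊖X ⊕ X`, which is the base point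
  have hI : gyr p P Q (base n p) = base n p := by
    rw [gyr, gadd_base hQ hQc, ← hX,
      gadd_eq hp (gneg_mem_Gr hp hPQ hPQc) (gneg_notMem_cutLocus hp hPQ hPQc),
      gtrans_gneg hp hPQ hPQc]
    nth_rewrite 2 [← gadd_base hPQ hPQc]
    rw [gadd_eq hp hPQ hPQc, transpose_conj_conj hX1]
  have h := hgyr (base n p)
  rw [hI] at h
  set O := (gtrans p X)ᵀ * gtrans p P * gtrans p Q
  nth_rewrite 2 [h]
  rw [mul_assoc (O * base n p), hO, mul_one]

end

section

variable {n p : ℕ} {P Q Δ A X : Matrix (Fin n) (Fin n) ℝ}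

/-! ### Existence of minimizing geodesics -/

/-- A real function applied to a symmetric matrix through its diagonalization. The result has the
eigenvectors of `A`, commutes with whatever commutes with `A`, and, when the function is odd,
anticommutes with whatever anticommutes with `A`. -/
theorem exists_functional_calculus (hA : Aᵀ = A) (f : ℝ → ℝ) :
    ∃ F : Matrix (Fin n) (Fin n) ℝ, Fᵀ = F ∧
      (∀ (v : Fin n → ℝ) (x : ℝ), A *ᵥ v = x • v → F *ᵥ v = f x • v) ∧
      (∀ X, A * X = X * A → F * X = X * F) ∧
      ((∀ x, f (-x) = -f x) → ∀ X, A * X = -(X * A) → F * X = -(X * F)) := by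
  obtain ⟨U, d, hU, hAU⟩ := exists_orthogonal_diagonalization hA
  have hU' := mul_eq_one_comm.1 hU
  have hA' : Uᵀ * A = diagonal d * Uᵀ := by
    have := congrArg transpose hAU
    simpa only [transpose_mul, hA, diagonal_transpose] using this
  set F := U * diagonal (fun i => f (d i)) * Uᵀ with hF
  have hFU : F * U = U * diagonal fun i => f (d i) := by rw [hF, mul_assoc, hU, mul_one]
  have hUF : Uᵀ * F = diagonal (fun i => f (d i)) * Uᵀ := by
    rw [hF, ← mul_assoc, ← mul_assoc, hU, one_mul]
  have hcancel : ∀ Y Y' : Matrix (Fin n) (Fin n) ℝ, Uᵀ * Y * U = Uᵀ * Y' * U → Y = Y' := by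
    intro Y Y' h
    have := congrArg (fun T => U * T * Uᵀ) h
    have e : ∀ T : Matrix (Fin n) (Fin n) ℝ, U * (Uᵀ * T * U) * Uᵀ = T := fun T => by
      calc _ = (U * Uᵀ) * T * (U * Uᵀ) := by simp only [mul_assoc]
        _ = T := by rw [hU', one_mul, mul_one]
    simpa only [e] using this
  have hl : ∀ X : Matrix (Fin n) (Fin n) ℝ,
      Uᵀ * (F * X) * U = diagonal (fun i => f (d i)) * (Uᵀ * X * U) := fun X => by
    rw [← mul_assoc, hUF]; simp only [mul_assoc]
  have hr : ∀ X : Matrix (Fin n) (Fin n) ℝ,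
      Uᵀ * (X * F) * U = Uᵀ * X * U * diagonal (fun i => f (d i)) := fun X => by
    simp only [mul_assoc, hFU]
  have hl' : ∀ X : Matrix (Fin n) (Fin n) ℝ,
      Uᵀ * (A * X) * U = diagonal d * (Uᵀ * X * U) := fun X => by
    rw [← mul_assoc, hA']; simp only [mul_assoc]
  have hr' : ∀ X : Matrix (Fin n) (Fin n) ℝ,
      Uᵀ * (X * A) * U = Uᵀ * X * U * diagonal d := fun X => by
    simp only [mul_assoc, hAU]
  refine ⟨F, ?_, fun v x hv => ?_, fun X hX => ?_, fun hf X hX => ?_⟩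
  · simp only [hF, transpose_mul, transpose_transpose, diagonal_transpose, mul_assoc]
  · have h1 : diagonal d *ᵥ (Uᵀ *ᵥ v) = x • (Uᵀ *ᵥ v) := by
      rw [Matrix.mulVec_mulVec, ← hA', ← Matrix.mulVec_mulVec, hv, Matrix.mulVec_smul]
    have h2 : diagonal (fun i => f (d i)) *ᵥ (Uᵀ *ᵥ v) = f x • (Uᵀ *ᵥ v) := by
      ext i
      have := congrFun h1 i
      rw [Matrix.mulVec_diagonal, Pi.smul_apply, smul_eq_mul] at this ⊢
      by_cases h0 : (Uᵀ *ᵥ v) i = 0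
      · rw [h0, mul_zero, mul_zero]
      · rw [mul_right_cancel₀ h0 this]
    rw [hF, mul_assoc, ← Matrix.mulVec_mulVec, ← Matrix.mulVec_mulVec, h2, Matrix.mulVec_smul,
      Matrix.mulVec_mulVec, hU', Matrix.one_mulVec]
  · refine hcancel _ _ ?_
    have h1 := hl' X
    rw [hX, hr'] at h1
    rw [hl, hr]
    ext i j
    have := congrFun (congrFun h1 i) j
    rw [Matrix.diagonal_mul, Matrix.mul_diagonal] at this ⊢
    by_cases h0 : (Uᵀ * X * U) i j = 0
    · rw [h0, mul_zero, zero_mul]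
    · rw [mul_comm] at this
      rw [mul_right_cancel₀ h0 this, mul_comm]
  · refine hcancel _ _ ?_
    have h1 := hl' X
    rw [hX, mul_neg, neg_mul, hr'] at h1
    rw [hl, mul_neg, neg_mul, hr]
    ext i j
    have := congrFun (congrFun h1 i) j
    rw [Matrix.neg_apply, Matrix.diagonal_mul, Matrix.mul_diagonal] at this ⊢
    by_cases h0 : (Uᵀ * X * U) i j = 0
    · rw [h0, mul_zero, zero_mul, neg_zero]
    · have e : d i = -d j := by
        refine mul_right_cancel₀ h0 ?_
        rw [← this]; ring
      rw [e, hf]; ring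

theorem finrank_range_inf_ker (P Q : Matrix (Fin n) (Fin n) ℝ) :
    Module.finrank ℝ ↥(LinearMap.range P.mulVecLin ⊓ LinearMap.ker Q.mulVecLin) + (Q * P).rank =
      P.rank := by
  have h := LinearMap.finrank_range_add_finrank_ker
    (Q.mulVecLin.domRestrict (LinearMap.range P.mulVecLin))
  have h1 : LinearMap.range (Q.mulVecLin.domRestrict (LinearMap.range P.mulVecLin)) =
      LinearMap.range (Q * P).mulVecLin := by
    rw [LinearMap.range_domRestrict, Matrix.mulVecLin_mul, LinearMap.range_comp]
  have h2 : Module.finrank ℝ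
        ↥(LinearMap.ker (Q.mulVecLin.domRestrict (LinearMap.range P.mulVecLin))) =
      Module.finrank ℝ ↥(LinearMap.range P.mulVecLin ⊓ LinearMap.ker Q.mulVecLin) := by
    rw [LinearMap.ker_domRestrict, ← Submodule.map_comap_subtype]
    exact (LinearEquiv.finrank_eq (Submodule.equivMapOfInjective _
      (Submodule.injective_subtype _) _))
  rw [h1, h2, add_comm] at h
  exact h

theorem finrank_range_inf_ker_comm (hP : P ∈ Gr n p) (hQ : Q ∈ Gr n p) :
    Module.finrank ℝ ↥(LinearMap.range P.mulVecLin ⊓ LinearMap.ker Q.mulVecLin) =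
      Module.finrank ℝ ↥(LinearMap.range Q.mulVecLin ⊓ LinearMap.ker P.mulVecLin) := by
  have h1 := finrank_range_inf_ker P Q
  have h2 := finrank_range_inf_ker Q P
  have h3 : (P * Q).rank = (Q * P).rank := by
    rw [← Matrix.rank_transpose (P * Q), transpose_mul, hP.1, hQ.1]
  rw [hP.2.2] at h1
  rw [hQ.2.2] at h2
  omega

/-- A matrix whose columns are a basis of a subspace of dimension `q`. -/
theorem exists_basis_matrix (N : Submodule ℝ (Fin n → ℝ)) {q : ℕ} (hq : Module.finrank ℝ N = q) :
    ∃ B : Matrix (Fin n) (Fin q) ℝ, (∀ c, B *ᵥ c = 0 → c = 0) ∧ (∀ c, B *ᵥ c ∈ N) ∧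
      ∀ x ∈ N, ∃ c, B *ᵥ c = x := by
  let b := Module.finBasisOfFinrankEq ℝ N hq
  have e : ∀ c, (Matrix.of fun i k => (b k : Fin n → ℝ) i) *ᵥ c =
      ((b.equivFun.symm c : N) : Fin n → ℝ) := fun c => by
    ext i
    rw [Module.Basis.equivFun_symm_apply]
    simp [Matrix.mulVec, dotProduct, mul_comm]
  refine ⟨Matrix.of fun i k => (b k : Fin n → ℝ) i, fun c hc => ?_, fun c => ?_, fun x hx => ?_⟩
  · rw [e] at hc
    exact (LinearEquiv.map_eq_zero_iff _).1 (Subtype.ext hc)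
  · rw [e]; exact Subtype.property _
  · exact ⟨b.equivFun ⟨x, hx⟩, by rw [e, LinearEquiv.symm_apply_apply]⟩

end

section

variable {n p : ℕ} {P Q Δ A X : Matrix (Fin n) (Fin n) ℝ}

/-- For subspaces of the same dimension there is a symmetric matrix exchanging
`range P ∩ ker Q` with `range Q ∩ ker P` and injective on their sum, which is the kernel of
`refl P + refl Q`. -/
theorem exists_swap (hP : P ∈ Gr n p) (hQ : Q ∈ Gr n p) :
    ∃ Z : Matrix (Fin n) (Fin n) ℝ, Zᵀ = Z ∧ Z * refl P = -(refl P * Z) ∧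
      refl Q * Z = -(refl P * Z) ∧
      ∀ x : Fin n → ℝ, (refl P + refl Q) *ᵥ x = 0 → Z *ᵥ x = 0 → x = 0 := by
  obtain ⟨q, hq⟩ : ∃ q, Module.finrank ℝ
      ↥(LinearMap.range P.mulVecLin ⊓ LinearMap.ker Q.mulVecLin) = q := ⟨_, rfl⟩
  obtain ⟨A, hA0, hA, hA'⟩ := exists_basis_matrix _ hq
  obtain ⟨B, hB0, hB, hB'⟩ := exists_basis_matrix _
    ((finrank_range_inf_ker_comm hP hQ).symm.trans hq)
  have hrange : ∀ {R : Matrix (Fin n) (Fin n) ℝ} {x : Fin n → ℝ}, R * R = R →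
      x ∈ LinearMap.range R.mulVecLin → R *ᵥ x = x := by
    rintro R _ hR ⟨y, rfl⟩
    rw [Matrix.mulVecLin_apply, Matrix.mulVec_mulVec, hR]
  have hPA : P * A = A := Matrix.mulVec_injective (funext fun c => by
    rw [← Matrix.mulVec_mulVec]; exact hrange hP.2.1 (hA c).1)
  have hQA : Q * A = 0 := Matrix.mulVec_injective (funext fun c => by
    rw [← Matrix.mulVec_mulVec, Matrix.zero_mulVec]; exact (hA c).2)
  have hQB : Q * B = B := Matrix.mulVec_injective (funext fun c => by
    rw [← Matrix.mulVec_mulVec]; exact hrange hQ.2.1 (hB c).1)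
  have hPB : P * B = 0 := Matrix.mulVec_injective (funext fun c => by
    rw [← Matrix.mulVec_mulVec, Matrix.zero_mulVec]; exact (hB c).2)
  have hAP : Aᵀ * P = Aᵀ := by rw [← hP.1, ← transpose_mul, hPA]
  have hBP : Bᵀ * P = 0 := by rw [← hP.1, ← transpose_mul, hPB, transpose_zero]
  have hBQ : Bᵀ * Q = Bᵀ := by rw [← hQ.1, ← transpose_mul, hQB]
  have hAQ : Aᵀ * Q = 0 := by rw [← hQ.1, ← transpose_mul, hQA, transpose_zero]
  have hPZ : P * (A * Bᵀ + B * Aᵀ) = A * Bᵀ := by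
    rw [Matrix.mul_add, ← Matrix.mul_assoc, ← Matrix.mul_assoc, hPA, hPB, Matrix.zero_mul, add_zero]
  have hQZ : Q * (A * Bᵀ + B * Aᵀ) = B * Aᵀ := by
    rw [Matrix.mul_add, ← Matrix.mul_assoc, ← Matrix.mul_assoc, hQA, hQB, Matrix.zero_mul, zero_add]
  have hZP : (A * Bᵀ + B * Aᵀ) * P = B * Aᵀ := by
    rw [Matrix.add_mul, Matrix.mul_assoc, Matrix.mul_assoc, hBP, hAP, Matrix.mul_zero, zero_add]
  refine ⟨A * Bᵀ + B * Aᵀ, ?_, ?_, ?_, fun x hx hZx => ?_⟩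
  · rw [transpose_add, transpose_mul, transpose_mul, transpose_transpose, transpose_transpose,
      add_comm]
  · rw [refl, mul_sub, sub_mul, mul_smul_comm, smul_mul_assoc, hPZ, hZP, mul_one, one_mul]
    module
  · rw [refl, refl, sub_mul, sub_mul, smul_mul_assoc, smul_mul_assoc, hPZ, hQZ, one_mul]
    module
  · -- `x = P x + Q x` with `P x ∈ ker Q` and `Q x ∈ ker P`
    have hsum : P *ᵥ x + Q *ᵥ x = x := by
      have e : refl P + refl Q = (2 : ℝ) • (P + Q - 1) := by rw [refl, refl]; module
      rw [e, Matrix.smul_mulVec, smul_eq_zero_iff_right two_ne_zero, Matrix.sub_mulVec,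
        Matrix.one_mulVec, sub_eq_zero, Matrix.add_mulVec] at hx
      exact hx
    have hPQ : P *ᵥ (Q *ᵥ x) = 0 := by
      have := congrArg (fun y => P *ᵥ y) hsum
      simpa [Matrix.mulVec_add, hP.2.1] using this
    have hQP : Q *ᵥ (P *ᵥ x) = 0 := by
      have := congrArg (fun y => Q *ᵥ y) hsum
      simpa [Matrix.mulVec_add, hQ.2.1] using this
    obtain ⟨a, ha⟩ := hA' (P *ᵥ x) ⟨⟨x, rfl⟩, hQP⟩
    obtain ⟨b, hb⟩ := hB' (Q *ᵥ x) ⟨⟨x, rfl⟩, hPQ⟩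
    have hBx : Bᵀ *ᵥ (B *ᵥ b) = 0 := by
      refine hA0 _ ?_
      have := congrArg (fun y => P *ᵥ y) hZx
      rw [Matrix.mulVec_mulVec, hPZ, Matrix.mulVec_zero] at this
      have e : Bᵀ *ᵥ (Q *ᵥ x) = Bᵀ *ᵥ x := by rw [Matrix.mulVec_mulVec, hBQ]
      rw [hb, e, Matrix.mulVec_mulVec, this]
    have hAx : Aᵀ *ᵥ (A *ᵥ a) = 0 := by
      refine hB0 _ ?_
      have := congrArg (fun y => Q *ᵥ y) hZx
      rw [Matrix.mulVec_mulVec, hQZ, Matrix.mulVec_zero] at this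
      have e : Aᵀ *ᵥ (P *ᵥ x) = Aᵀ *ᵥ x := by rw [Matrix.mulVec_mulVec, hAP]
      rw [ha, e, Matrix.mulVec_mulVec, this]
    have hzero : ∀ {q : ℕ} (C : Matrix (Fin n) (Fin q) ℝ) (c : Fin q → ℝ),
        Cᵀ *ᵥ (C *ᵥ c) = 0 → C *ᵥ c = 0 := fun C c h => by
      rw [← dotProduct_self_eq_zero, Matrix.dotProduct_mulVec, ← Matrix.mulVec_transpose, h,
        zero_dotProduct]
    rw [← hsum, ← ha, ← hb, hzero A a hAx, hzero B b hBx, add_zero]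

/-- The midpoint reflection: an orthogonal reflection `V` with `V J V = K`, for the reflections
`J` and `K` in two subspaces of the same dimension, chosen such that the angle from `J` to `V` is
acute: `VJ + JV` is the square of a symmetric matrix. -/
theorem exists_midpoint (hP : P ∈ Gr n p) (hQ : Q ∈ Gr n p) :
    ∃ V S : Matrix (Fin n) (Fin n) ℝ, Vᵀ = V ∧ Sᵀ = S ∧ V * V = 1 ∧
      V * refl P * V = refl Q ∧ V * refl P + refl P * V = S * S := by
  obtain ⟨Z, hZt, hZJ, hKZ, hZ0⟩ := exists_swap hP hQ
  have hJt := transpose_refl hP.1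
  have hKt := transpose_refl hQ.1
  have hJ := refl_mul_self hP.2.1
  have hK := refl_mul_self hQ.2.1
  set J := refl P
  set K := refl Q
  set M := J + K with hM
  have hMt : Mᵀ = M := by rw [hM, transpose_add, hJt, hKt]
  have hMZ : M * Z = 0 := by rw [hM, add_mul, hKZ, add_neg_cancel]
  have hZM : Z * M = 0 := by
    have := congrArg transpose hMZ
    rwa [transpose_mul, hZt, hMt, transpose_zero] at this
  have hNt : (M + Z)ᵀ = M + Z := by rw [transpose_add, hMt, hZt]
  have hNJ : (M + Z) * J = K * (M + Z) := by
    simp only [hM, add_mul, mul_add, hJ, hK, hKZ, hZJ]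
    abel
  have hNK : (M + Z) * K = J * (M + Z) := by
    have := congrArg transpose hNJ
    rw [transpose_mul, transpose_mul, hNt, hJt, hKt] at this
    exact this.symm
  have hN0 : ∀ x : Fin n → ℝ, (M + Z) *ᵥ x = 0 → x = 0 := by
    intro x hx
    have hself : ∀ {C : Matrix (Fin n) (Fin n) ℝ} {y : Fin n → ℝ}, Cᵀ = C →
        C *ᵥ (C *ᵥ y) = 0 → C *ᵥ y = 0 := fun {C y} hC h => by
      rw [← dotProduct_self_eq_zero, Matrix.dotProduct_mulVec, ← Matrix.mulVec_transpose, hC, h,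
        zero_dotProduct]
    have h1 : M *ᵥ x = 0 := by
      refine hself hMt ?_
      have := congrArg (fun y => M *ᵥ y) hx
      rw [Matrix.mulVec_mulVec, mul_add, hMZ, add_zero, Matrix.mulVec_zero] at this
      rw [Matrix.mulVec_mulVec, this]
    refine hZ0 x h1 ?_
    rwa [Matrix.add_mulVec, h1, zero_add] at hx
  set N := M + Z with hN
  have hWt : (N * N)ᵀ = N * N := by rw [transpose_mul, hNt]
  -- `r` is the inverse fourth root of `N²`, so that `r N r` is the sign of `N`
  obtain ⟨r, hrt, hrv, hrc, -⟩ := exists_functional_calculus hWt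
    fun x => (Real.sqrt (Real.sqrt x))⁻¹
  have hrN : r * N = N * r := hrc N (mul_assoc _ _ _)
  have hrM : r * M = M * r := by
    refine hrc M ?_
    have e1 : N * M = M * M := by rw [hN, add_mul, hZM, add_zero]
    have e2 : M * N = M * M := by rw [hN, mul_add, hMZ, add_zero]
    have e : N * M = M * N := e1.trans e2.symm
    rw [mul_assoc, e, ← mul_assoc, e, mul_assoc]
  have hrJ : r * J = J * r := hrc J (by rw [mul_assoc, hNJ, ← mul_assoc, hNK, mul_assoc])
  have hrK : r * K = K * r := hrc K (by rw [mul_assoc, hNK, ← mul_assoc, hNJ, mul_assoc])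
  have hr4 : r * r * (r * r) * (N * N) = 1 := by
    obtain ⟨U, d, hU, hWU⟩ := exists_orthogonal_diagonalization hWt
    refine eq_of_mulVec_eq hU fun j => ?_
    have hv := mulVec_eq_of_mul_eq_mul_diagonal hWU j
    have hvv : Uᵀ j ⬝ᵥ Uᵀ j = 1 := by
      have := congrFun (congrFun hU j) j
      rwa [Matrix.one_apply_eq] at this
    have hd : 0 < d j := by
      have h1 : (N *ᵥ Uᵀ j) ⬝ᵥ (N *ᵥ Uᵀ j) = d j := by
        rw [Matrix.dotProduct_mulVec, ← Matrix.mulVec_transpose, hNt, Matrix.mulVec_mulVec, hv,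
          smul_dotProduct, hvv, smul_eq_mul, mul_one]
      refine lt_of_le_of_ne (h1 ▸ Finset.sum_nonneg fun i _ => mul_self_nonneg _) fun h0 => ?_
      rw [← h0, dotProduct_self_eq_zero] at h1
      rw [hN0 _ h1, dotProduct_zero] at hvv
      exact zero_ne_one hvv
    have hs := Real.sqrt_pos.2 hd
    have hss := Real.sqrt_pos.2 hs
    rw [← Matrix.mulVec_mulVec, hv, Matrix.one_mulVec]
    simp only [← Matrix.mulVec_mulVec, Matrix.mulVec_smul, hrv _ _ hv, smul_smul]
    have e : d j * ((Real.sqrt (Real.sqrt (d j)))⁻¹ * ((Real.sqrt (Real.sqrt (d j)))⁻¹ *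
        ((Real.sqrt (Real.sqrt (d j)))⁻¹ * (Real.sqrt (Real.sqrt (d j)))⁻¹))) = 1 := by
      have h1 : d j = Real.sqrt (Real.sqrt (d j)) * Real.sqrt (Real.sqrt (d j)) *
          (Real.sqrt (Real.sqrt (d j)) * Real.sqrt (Real.sqrt (d j))) := by
        rw [Real.mul_self_sqrt hs.le, Real.mul_self_sqrt hd.le]
      nth_rewrite 1 [h1]
      field_simp
    convert one_smul ℝ _ using 2
    rw [← e]; ring
  have hV : r * r * N = N * (r * r) := by rw [mul_assoc, hrN, ← mul_assoc, hrN, mul_assoc]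
  have hVJ : r * r * N * J = K * (r * r * N) := by
    rw [mul_assoc, hNJ, ← mul_assoc, mul_assoc r, hrK, ← mul_assoc, hrK]
    simp only [mul_assoc]
  have hVV : r * r * N * (r * r * N) = 1 := by
    rw [mul_assoc (r * r) N, ← mul_assoc N, ← hV, mul_assoc (r * r) N N, ← mul_assoc, hr4]
  refine ⟨r * r * N, r * M, ?_, ?_, hVV, ?_, ?_⟩
  · rw [transpose_mul, transpose_mul, hrt, hNt, hV]
  · rw [transpose_mul, hrt, hMt, hrM]
  · rw [hVJ, mul_assoc, hVV, mul_one]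
  · have e1 : J * (r * r * N) = r * r * (J * N) := by
      rw [← mul_assoc, ← mul_assoc, ← hrJ, mul_assoc r J, ← hrJ]
      simp only [mul_assoc]
    have e2 : N * J + J * N = M * M := by
      simp only [hN, hM, mul_add, add_mul, hZJ, hJ, hK]
      abel
    rw [e1, mul_assoc (r * r), ← mul_add, e2, mul_assoc r M, ← mul_assoc M, ← hrM]
    simp only [mul_assoc]

end

section

variable {n p : ℕ} {P Q Δ A X : Matrix (Fin n) (Fin n) ℝ}

theorem dotProduct_mulVec_symm (hA : Aᵀ = A) (x y : Fin n → ℝ) :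
    x ⬝ᵥ (A *ᵥ y) = (A *ᵥ x) ⬝ᵥ y := by
  rw [Matrix.dotProduct_mulVec, ← Matrix.mulVec_transpose, hA]

theorem dotProduct_self_nonneg_real (x : Fin n → ℝ) : 0 ≤ x ⬝ᵥ x :=
  Finset.sum_nonneg fun _ _ => mul_self_nonneg _

/-- A positive semidefinite matrix acts on an eigenvector of its square by the square root of the
eigenvalue, which is nonnegative. -/
theorem mulVec_eq_sqrt_smul (hA : Aᵀ = A) (hpos : ∀ x : Fin n → ℝ, 0 ≤ x ⬝ᵥ (A *ᵥ x))
    {v : Fin n → ℝ} {x : ℝ} (hv0 : v ≠ 0) (hv : A *ᵥ (A *ᵥ v) = x • v) :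
    0 ≤ x ∧ A *ᵥ v = Real.sqrt x • v := by
  have hvpos : 0 < v ⬝ᵥ v := lt_of_le_of_ne (dotProduct_self_nonneg_real v)
    fun h => hv0 (dotProduct_self_eq_zero.1 h.symm)
  have h1 : (A *ᵥ v) ⬝ᵥ (A *ᵥ v) = x * (v ⬝ᵥ v) := by
    rw [← dotProduct_mulVec_symm hA, hv, dotProduct_smul, smul_eq_mul]
  have hx : 0 ≤ x := by
    have := dotProduct_self_nonneg_real (A *ᵥ v)
    rw [h1] at this
    exact nonneg_of_mul_nonneg_left this hvpos
  refine ⟨hx, ?_⟩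
  rcases hx.eq_or_lt with h0 | h0
  · rw [← h0, zero_mul, dotProduct_self_eq_zero] at h1
    rw [h1, ← h0, Real.sqrt_zero, zero_smul]
  · -- `u = A v - √x v` would be an eigenvector for the negative eigenvalue `-√x`
    have hs := Real.sqrt_pos.2 h0
    set u := A *ᵥ v - Real.sqrt x • v with hu
    have hAu : A *ᵥ u = -(Real.sqrt x • u) := by
      rw [hu, Matrix.mulVec_sub, Matrix.mulVec_smul, hv, smul_sub, smul_smul,
        Real.mul_self_sqrt hx]
      abel
    have h2 := hpos u
    rw [hAu, dotProduct_neg, dotProduct_smul, smul_eq_mul] at h2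
    have h3 := dotProduct_self_nonneg_real u
    have h4 : u ⬝ᵥ u = 0 := by nlinarith
    exact sub_eq_zero.1 (dotProduct_self_eq_zero.1 h4)

/-- Any two points are joined by a geodesic. The initial velocity is the arcsine of the odd part
of the midpoint reflection. -/
theorem exists_isExp (hP : P ∈ Gr n p) (hQ : Q ∈ Gr n p) : ∃ Δ, IsExp p P Δ Q := by
  obtain ⟨V, S, hVt, hSt, hVV, hVJV, hS⟩ := exists_midpoint hP hQ
  have hJt := transpose_refl hP.1
  have hJ := refl_mul_self hP.2.1
  set J := refl P
  -- sine and cosine of the tangent vector to be found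
  set s := (2⁻¹ : ℝ) • (V - J * V * J) with hs
  set c := (2⁻¹ : ℝ) • (V * J + J * V) with hc
  have hst : sᵀ = s := by
    simp only [hs, transpose_smul, transpose_sub, transpose_mul, hJt, hVt, mul_assoc]
  have hct : cᵀ = c := by
    rw [hc, transpose_smul, transpose_add, transpose_mul, transpose_mul, hJt, hVt, add_comm]
  have hJJ : ∀ Y, J * (J * Y) = Y := fun Y => by rw [← mul_assoc, hJ, one_mul]
  have hVV' : ∀ Y, V * (V * Y) = Y := fun Y => by rw [← mul_assoc, hVV, one_mul]
  have hsJ : s * J = -(J * s) := by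
    simp only [hs, smul_mul_assoc, mul_smul_comm, mul_sub, sub_mul, mul_assoc, hJ, hJJ, mul_one]
    module
  have hcc : c * c = 1 - s * s := by
    simp only [hs, hc, smul_mul_assoc, mul_smul_comm, mul_sub, sub_mul, mul_add, add_mul,
      mul_assoc, hJ, hJJ, hVV, hVV']
    module
  have hcs : c + s * J = V * J := by
    simp only [hs, hc, smul_mul_assoc, sub_mul, mul_assoc, hJ, mul_one]
    module
  have hcpos : ∀ x : Fin n → ℝ, 0 ≤ x ⬝ᵥ (c *ᵥ x) := fun x => by
    rw [hc, hS, Matrix.smul_mulVec, dotProduct_smul, ← Matrix.mulVec_mulVec,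
      dotProduct_mulVec_symm hSt, smul_eq_mul]
    have := dotProduct_self_nonneg_real (S *ᵥ x)
    positivity
  obtain ⟨Δ, hΔt, hΔv, -, hΔodd⟩ := exists_functional_calculus hst Real.arcsin
  have hΔJ : Δ * J = -(J * Δ) := hΔodd Real.arcsin_neg J hsJ
  have hexp : NormedSpace.exp (Δ * J) = V * J := by
    obtain ⟨U, d, hU, hsU⟩ := exists_orthogonal_diagonalization hst
    refine eq_of_mulVec_eq hU fun j => ?_
    have hv := mulVec_eq_of_mul_eq_mul_diagonal hsU j
    have hv0 : Uᵀ j ≠ 0 := fun h0 => by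
      have : Uᵀ j ⬝ᵥ Uᵀ j = 1 := by
        have := congrFun (congrFun hU j) j
        rwa [Matrix.one_apply_eq] at this
      rw [h0, dotProduct_zero] at this
      exact zero_ne_one this
    generalize Uᵀ j = v at hv hv0
    generalize d j = x at hv
    have hccv : c *ᵥ (c *ᵥ v) = (1 - x * x) • v := by
      rw [Matrix.mulVec_mulVec, hcc, Matrix.sub_mulVec, ← Matrix.mulVec_mulVec, hv,
        Matrix.mulVec_smul, hv, Matrix.one_mulVec, smul_smul, sub_smul, one_smul]
    obtain ⟨hx, hcv⟩ := mulVec_eq_sqrt_smul hct hcpos hv0 hccv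
    have hx1 := abs_le.1 (abs_le_one_iff_mul_self_le_one.2 (sub_nonneg.1 hx))
    have := exp_smul_mulVec hJ hΔJ (hΔv v x hv) 1
    rw [one_smul, one_mul, Real.cos_arcsin, Real.sin_arcsin hx1.1 hx1.2] at this
    rw [this, ← hcs, Matrix.add_mulVec, hcv, hsJ, Matrix.neg_mulVec, ← Matrix.mulVec_mulVec, hv,
      Matrix.mulVec_smul, sq, sub_eq_add_neg]
  refine ⟨Δ, (isExp_iff hP).2 ⟨mem_tangent_iff.2 ⟨hΔt, hΔJ⟩, ?_⟩⟩
  rw [two_smul, Matrix.exp_add_of_commute _ _ (Commute.refl _), hexp, ← hVJV]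
  simp only [mul_assoc]
  rw [hJ, mul_one]

theorem continuous_exp_matrix :
    Continuous (NormedSpace.exp : Matrix (Fin n) (Fin n) ℝ → Matrix (Fin n) (Fin n) ℝ) := by
  open scoped Matrix.Norms.Operator in exact NormedSpace.exp_continuous

theorem sq_apply_le_frobInner (X : Matrix (Fin n) (Fin n) ℝ) (i j : Fin n) :
    X i j * X i j ≤ frobInner X X := by
  have e : frobInner X X = ∑ k, ∑ l, X l k * X l k := by
    simp [frobInner, Matrix.trace, Matrix.mul_apply]
  rw [e]
  refine le_trans ?_ (Finset.single_le_sum (f := fun k => ∑ l, X l k * X l k)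
    (fun k _ => Finset.sum_nonneg fun l _ => mul_self_nonneg _) (Finset.mem_univ j))
  exact Finset.single_le_sum (f := fun l => X l j * X l j)
    (fun l _ => mul_self_nonneg _) (Finset.mem_univ i)

/-- Any two points are joined by a minimizing geodesic: the initial velocities of the geodesics
from `P` to `Q` form a nonempty closed set, and sublevel sets of the norm are compact. -/
theorem exists_isMinimizing (hP : P ∈ Gr n p) (hQ : Q ∈ Gr n p) :
    ∃ Δ, IsMinimizing p P Q Δ := by
  obtain ⟨D, hD⟩ := exists_isExp hP hQ
  have hcf : Continuous fun X : Matrix (Fin n) (Fin n) ℝ => frobInner X X :=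
    (continuous_id.matrix_transpose.matrix_mul continuous_id).matrix_trace
  set T : Set (Matrix (Fin n) (Fin n) ℝ) := {X | IsExp p P X Q} with hT
  have hTclosed : IsClosed T := by
    have e : T = {X | Xᵀ = X} ∩ {X | X * P + P * X = X} ∩
        {X | refl Q = NormedSpace.exp ((2 : ℝ) • (X * refl P)) * refl P} := by
      ext X
      exact isExp_iff hP
    rw [e]
    refine ((isClosed_eq continuous_id.matrix_transpose continuous_id).inter
      (isClosed_eq ?_ continuous_id)).inter (isClosed_eq continuous_const ?_)
    · exact (continuous_id.matrix_mul continuous_const).add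
        (continuous_const.matrix_mul continuous_id)
    · exact (continuous_exp_matrix.comp
        ((continuous_id.matrix_mul continuous_const).const_smul (2 : ℝ))).matrix_mul
          continuous_const
  set C := frobInner D D with hC
  have hbox : IsCompact {X : Matrix (Fin n) (Fin n) ℝ |
      ∀ i, X i ∈ {x : Fin n → ℝ | ∀ j, x j ∈ Set.Icc (-Real.sqrt C) (Real.sqrt C)}} :=
    isCompact_pi_infinite fun _ => isCompact_pi_infinite fun _ => isCompact_Icc
  have hK : IsCompact (T ∩ {X | frobInner X X ≤ C}) := by
    refine hbox.of_isClosed_subset (hTclosed.inter (isClosed_le hcf continuous_const)) ?_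
    rintro X ⟨-, hX⟩ i j
    have h1 : X i j * X i j ≤ C := (sq_apply_le_frobInner X i j).trans hX
    exact abs_le.1 (Real.abs_le_sqrt (by rwa [sq]))
  obtain ⟨Δ, hΔ, hmin⟩ := hK.exists_isMinOn ⟨D, hD, le_refl C⟩ hcf.continuousOn
  refine ⟨Δ, hΔ.1, fun Δ' hΔ' => Real.sqrt_le_sqrt ?_⟩
  by_cases h : frobInner Δ' Δ' ≤ C
  · exact hmin ⟨hΔ', h⟩
  · exact le_trans hΔ.2 (not_le.1 h).le

end

/-! ### Invariance of the gyrodistance -/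

section

variable {n p : ℕ} {O P Q R S : Matrix (Fin n) (Fin n) ℝ}

theorem gnorm_conj (hp : p ≤ n) (hO : Oᵀ * O = 1) (hOP : O * base n p = base n p * O)
    (hQ : Q ∈ Gr n p) : gnorm p (O * Q * Oᵀ) = gnorm p Q :=
  frobNorm_log_conj (base_mem_Gr hp) hO hOP (exists_isMinimizing (base_mem_Gr hp) hQ)

/-- Conjugation by an orthogonal matrix fixing the base point is compatible with
`(R, S) ↦ ⊖R ⊕ S` when `R` is off the cut locus. -/
theorem gadd_gneg_conj (hp : p ≤ n) (hO : Oᵀ * O = 1) (hOP : O * base n p = base n p * O)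
    (hR : R ∈ Gr n p) (hc : R ∉ cutLocus p (base n p)) (S : Matrix (Fin n) (Fin n) ℝ) :
    gadd p (gneg p (O * R * Oᵀ)) (O * S * Oᵀ) = O * gadd p (gneg p R) S * Oᵀ := by
  have hI := base_mem_Gr hp
  have hn := gneg_mem_Gr hp hR hc
  have hnc := gneg_notMem_cutLocus hp hR hc
  rw [gneg_conj hp hO hOP hR hc, gadd_eq hp (conj_mem_Gr hO hn)
    (conj_notMem_cutLocus hI hO hOP hn hnc), gtrans_conj hp hO hOP hn hnc, gadd_eq hp hn hnc]
  have e : (O * gtrans p (gneg p R) * Oᵀ)ᵀ = O * (gtrans p (gneg p R))ᵀ * Oᵀ := by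
    simp only [transpose_mul, transpose_transpose, mul_assoc]
  rw [e, conj_mul_conj hO, conj_mul_conj hO]

end

end Grassmann

end

theorem mainTheorem7 (n p : ℕ) (hp : p ≤ n) (P Q : Matrix (Fin n) (Fin n) ℝ)
    (hP : P ∈ Grassmann.Gr n p) (hQ : Q ∈ Grassmann.Gr n p)
    (hPc : P ∉ Grassmann.cutLocus p (Grassmann.base n p))
    (hQc : Q ∉ Grassmann.cutLocus p (Grassmann.base n p))
    (hPQc : Grassmann.gadd p P Q ∉ Grassmann.cutLocus p (Grassmann.base n p)) :
    (∀ R ∈ Grassmann.Gr n p, Grassmann.gyr p P Q R ∈ Grassmann.Gr n p) ∧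
    ∀ R ∈ Grassmann.Gr n p, ∀ S ∈ Grassmann.Gr n p,
      R ∉ Grassmann.cutLocus p (Grassmann.base n p) →
        Grassmann.gyr p P Q R ∉ Grassmann.cutLocus p (Grassmann.base n p) ∧
        (Grassmann.gadd p (Grassmann.gneg p R) S ∉
            Grassmann.cutLocus p (Grassmann.base n p) →
          Grassmann.gadd p (Grassmann.gneg p (Grassmann.gyr p P Q R))
              (Grassmann.gyr p P Q S) ∉ Grassmann.cutLocus p (Grassmann.base n p)) ∧
        Grassmann.gdist p (Grassmann.gyr p P Q R) (Grassmann.gyr p P Q S) =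
          Grassmann.gdist p R S := by
  obtain ⟨O, hO, hOI, hgyr⟩ := Grassmann.exists_gyr_eq_conj hp hP hQ hPc hQc hPQc
  have hI := Grassmann.base_mem_Gr hp
  refine ⟨fun R hR => hgyr R ▸ Grassmann.conj_mem_Gr hO hR, fun R hR S hS hRc => ?_⟩
  have hT : Grassmann.gadd p (Grassmann.gneg p R) S ∈ Grassmann.Gr n p :=
    Grassmann.gadd_mem_Gr hp (Grassmann.gneg_mem_Gr hp hR hRc)
      (Grassmann.gneg_notMem_cutLocus hp hR hRc) hS
  rw [Grassmann.gdist, hgyr R, hgyr S, Grassmann.gadd_gneg_conj hp hO hOI hR hRc]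
  exact ⟨Grassmann.conj_notMem_cutLocus hI hO hOI hR hRc,
    fun h => Grassmann.conj_notMem_cutLocus hI hO hOI hT h,
    Grassmann.gnorm_conj hp hO hOI hT⟩
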